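/- **Theorem 4.4.** Notation: for $r\in[0,1)$ let $\mathbb A_r:=\{z\in\mathbb C: r<|z|<1\}$, let $\mathbb D^*:=\mathbb A_0$ be the punctured unit disk, and let $\omega(r):=-\pi/\log r$ for $r\in(0,1)$, $\omega(0):=0$. For $d\in[1,+\infty]$ and an interval $X\subset\mathbb R$, $AC^d(X,Y)$ is the class of all locally absolutely continuous functions $f:X\to Y$ with $f'\in L^d_{\rm loc}(X)$. A family $(D_t)_{t\ge0}$, $D_t=\mathbb A_{r(t)}$ with $r:[0,+\infty)\to[0,1)$, is a *canonical domain system of order $d$* if $t\mapsto\omega(r(t))$ is non-increasing and belongs to $AC^d([0,+\infty),[0,+\infty))$. For $1>r_1\ge r_2\ge0$, $\mathbb M(r_1,r_2)$ is the class of all holomorphic $\psi:\mathbb A_{r_1}\to\mathbb A_{r_2}$ such that $I(\psi\circ\gamma)=I(\gamma)$ for every closed curve $\gamma\subset\mathbb A_{r_1}$, where $I(\gamma)$ is the index (winding number) of the origin with respect to $\gamma$. A family $(\varphi_{s,t})_{0\le s\le t<+\infty}$ of holomorphic maps $\varphi_{s,t}:D_s\to D_t$ is an *$L^d$-evolution family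 over $(D_t)$* if - EF1. $\varphi_{s,s}=\mathsf{id}_{D_s}$ for all $s\ge0$; - EF2. $\varphi_{s,t}=\varphi_{u,t}\circ\varphi_{s,u}$ whenever $0\le s\le u\le t<+\infty$; - EF3. for every $[S,T]\subset[0,+\infty)$ and every $z\in D_S$ there is a non-negative $k\in L^d([S,T],\mathbb R)$ such that $|\varphi_{s,u}(z)-\varphi_{s,t}(z)|\le\int_u^t k(\xi)\,d\xi$ whenever $S\le s\le u\le t\le T$. Statement: let $d\in[1,+\infty]$, let $(D_t)=(\mathbb A_{r(t)})$ be a canonical domain system of order $d$, and let $(\varphi_{s,t})_{0\le s\le t}$ be a family of holomorphic functions $\varphi_{s,t}:D_s\to D_t$ satisfying EF1 and EF2. Suppose that at least one of the following conditions holds: - (a) for each $t>0$, each $s_0\in[0,t)$ and each $z\in D_{s_0}$ the mapping $[s_0,t]\ni s\mapsto\varphi_{s,t}(z)\in\mathbb D^*$ is continuous; - (b) for each $s\ge0$ and each $z\in D_s$ the mapping $[s,+\infty)\ni t\mapsto\varphi_{s,t}(z)\in\mathbb D^*$ is continuous; - (c) for each $s\ge0$ and each $t\ge s$ the function $\varphi_{s,t}$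 belongs to $\mathbb M(r(s),r(t))$. If there exists a point $z_0\in D_0$ such that $t\mapsto\varphi_{0,t}(z_0)$ belongs to $AC^d([0,+\infty),\mathbb D^*)$, then $(\varphi_{s,t})$ is an $L^d$-evolution family over $(D_t)$. -/

import Mathlib

open Set MeasureTheory
open scoped ENNReal

noncomputable section

/-- The annulus `{z : r < |z| < 1}`; for `r = 0` it is the punctured unit disk. -/
def annulus (r : ℝ) : Set ℂ := {z | r < ‖z‖ ∧ ‖z‖ < 1}

/-- The punctured unit disk. -/
def puncturedDisk : Set ℂ := {z | z ≠ 0 ∧ ‖z‖ < 1}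

/-- The function `ω` on `[0, 1)`: `ω(r) = -π / log r` for `r ∈ (0, 1)` and `ω(0) = 0`. -/
def annulusOmega (r : ℝ) : ℝ := if r = 0 then 0 else -Real.pi / Real.log r

/-- The class `AC^d(X, Y)`, for an interval `X` of the real line: functions with values in `Y`
that are absolutely continuous on every compact subinterval of `X`, with derivative in `L^d`
on every compact subinterval of `X`. (An absolutely continuous function has a
derivative at almost every point, and `deriv` takes the value `0` at the other points.) -/
structure IsACd {E : Type*} [NormedAddCommGroup E] [NormedSpace ℝ E]
    (d : ℝ≥0∞) (X : Set ℝ) (Y : Set E) (f : ℝ → E) : Prop where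
  mapsTo : MapsTo f X Y
  absolutelyContinuous : ∀ a b, a ≤ b → Icc a b ⊆ X → AbsolutelyContinuousOnInterval f a b
  deriv_memLp : ∀ a b, a ≤ b → Icc a b ⊆ X → MemLp (deriv f) d (volume.restrict (Icc a b))

/-- `(annulus (r t))_{t ≥ 0}` is a canonical domain system of order `d`. -/
structure IsCanonicalSystem (d : ℝ≥0∞) (r : ℝ → ℝ) : Prop where
  mem_Ico : ∀ t, 0 ≤ t → r t ∈ Ico (0 : ℝ) 1
  omega_ACd : IsACd d (Ici 0) (Ici 0) (fun t => annulusOmega (r t))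
  omega_antitone : AntitoneOn (fun t => annulusOmega (r t)) (Ici 0)

/-- `(φ s t)_{0 ≤ s ≤ t}` is a family of holomorphic maps from `annulus (r s)` to `annulus (r t)`
with the algebraic properties EF1 and EF2. Only the values of `φ s t` on `annulus (r s)`, for
`0 ≤ s ≤ t`, matter. -/
structure IsAlgebraicEvolutionFamily (r : ℝ → ℝ) (φ : ℝ → ℝ → ℂ → ℂ) : Prop where
  mapsTo : ∀ s t, 0 ≤ s → s ≤ t → MapsTo (φ s t) (annulus (r s)) (annulus (r t))
  holomorphic : ∀ s t, 0 ≤ s → s ≤ t → DifferentiableOn ℂ (φ s t) (annulus (r s))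
  EF1 : ∀ s, 0 ≤ s → ∀ z ∈ annulus (r s), φ s s z = z
  EF2 : ∀ s u t, 0 ≤ s → s ≤ u → u ≤ t → ∀ z ∈ annulus (r s), φ s t z = φ u t (φ s u z)

/-- `(φ s t)_{0 ≤ s ≤ t}` is an evolution family of order `d` over `(annulus (r t))_{t ≥ 0}`. -/
structure IsEvolutionFamily (d : ℝ≥0∞) (r : ℝ → ℝ) (φ : ℝ → ℝ → ℂ → ℂ) : Prop
    extends IsAlgebraicEvolutionFamily r φ where
  EF3 : ∀ S T, 0 ≤ S → S ≤ T → ∀ z ∈ annulus (r S), ∃ k : ℝ → ℝ,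
    (∀ ξ ∈ Icc S T, 0 ≤ k ξ) ∧ MemLp k d (volume.restrict (Icc S T)) ∧
    ∀ s u t, S ≤ s → s ≤ u → u ≤ t → t ≤ T →
      ‖φ s u z - φ s t z‖ ≤ ∫ ξ in u..t, k ξ

/-- `n` is the index of the origin with respect to the closed curve `γ : [0, 1] → ℂ \ {0}`: the
increment along `γ` of a continuous branch of the logarithm is `2πin`. -/
def HasWindingIndex (γ : ℝ → ℂ) (n : ℤ) : Prop :=
  ∃ L : ℝ → ℂ, ContinuousOn L (Icc 0 1) ∧ (∀ x ∈ Icc (0 : ℝ) 1, Complex.exp (L x) = γ x) ∧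
    L 1 - L 0 = 2 * Real.pi * Complex.I * n

/-- The index is well defined for every closed curve that avoids the origin. -/
theorem existsUnique_hasWindingIndex {γ : ℝ → ℂ} (hγ : ContinuousOn γ (Icc 0 1))
    (h0 : ∀ x ∈ Icc (0 : ℝ) 1, γ x ≠ 0) (hc : γ 0 = γ 1) : ∃! n, HasWindingIndex γ n := by
  have m0 : (0 : ℝ) ∈ Icc (0 : ℝ) 1 := by simp
  have m1 : (1 : ℝ) ∈ Icc (0 : ℝ) 1 := by simp
  let g : C(unitInterval, {z : ℂ // z ≠ 0}) :=
    ⟨fun x => ⟨γ x, h0 x x.2⟩, (continuousOn_iff_continuous_domRestrict.mp hγ).subtype_mk _⟩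
  have key : ∀ L : C(unitInterval, ℂ), (∀ x : unitInterval, Complex.exp (L x) = γ x) ↔
      (fun z : ℂ => (⟨_, z.exp_ne_zero⟩ : {z : ℂ // z ≠ 0})) ∘ L = g := by
    intro L
    constructor
    · intro h; funext x; exact Subtype.ext (h x)
    · intro h x; exact congrArg Subtype.val (congrFun h x)
  obtain ⟨Γ, hΓ, -⟩ := Complex.isCoveringMap_exp.exists_path_lifts g
    (Complex.log (γ 0)) (Subtype.ext (Complex.exp_log (h0 0 m0)).symm)
  rw [← key] at hΓ
  have hL : ContinuousOn (fun x => Γ (projIcc 0 1 zero_le_one x)) (Icc 0 1) :=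
    (Γ.continuous.comp continuous_projIcc).continuousOn
  have hexp : ∀ x ∈ Icc (0 : ℝ) 1, Complex.exp (Γ (projIcc 0 1 zero_le_one x)) = γ x := by
    intro x hx; rw [hΓ, projIcc_of_mem _ hx]
  obtain ⟨n, hn⟩ := Complex.exp_eq_exp_iff_exists_int.mp
    ((hexp 1 m1).trans (hc.symm.trans (hexp 0 m0).symm))
  refine ⟨n, ⟨_, hL, hexp, by rw [hn]; ring⟩, ?_⟩
  rintro m ⟨M, hM, hMexp, hm⟩
  -- the difference of two branches is constant, since `exp` is a covering map
  obtain ⟨c, hcM⟩ := Complex.exp_eq_exp_iff_exists_int.mp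
    ((hMexp 0 m0).trans (hexp 0 m0).symm)
  let M' : C(unitInterval, ℂ) :=
    ⟨fun x => M x - c * (2 * Real.pi * Complex.I),
      (continuousOn_iff_continuous_domRestrict.mp hM).sub continuous_const⟩
  have hM' : ∀ x : unitInterval, Complex.exp (M' x) = γ x := by
    intro x
    rw [← hMexp x x.2]
    refine Complex.exp_eq_exp_iff_exists_int.mpr ⟨-c, ?_⟩
    change M x - c * (2 * Real.pi * Complex.I) = _
    push_cast; ring
  have heq : (M' : unitInterval → ℂ) = Γ := by
    refine Complex.isCoveringMap_exp.eq_of_comp_eq M'.continuous Γ.continuous ?_ 0 ?_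
    · rw [(key M').mp hM', (key Γ).mp hΓ]
    · have := hcM
      rw [projIcc_of_mem _ m0] at this
      change M 0 - _ = Γ ⟨0, m0⟩
      rw [this]; ring
  have e0 : M 0 - c * (2 * Real.pi * Complex.I) = Γ (projIcc 0 1 zero_le_one 0) := by
    rw [projIcc_of_mem _ m0]; exact congrFun heq ⟨0, m0⟩
  have e1 : M 1 - c * (2 * Real.pi * Complex.I) = Γ (projIcc 0 1 zero_le_one 1) := by
    rw [projIcc_of_mem _ m1]; exact congrFun heq ⟨1, m1⟩
  have : (2 * Real.pi * Complex.I) * (m : ℂ) = (2 * Real.pi * Complex.I) * n := by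
    rw [← hm]
    linear_combination e1 - e0 + hn
  exact_mod_cast mul_left_cancel₀ Complex.two_pi_I_ne_zero this

open Classical in
/-- The index `I(γ)` of the origin with respect to a closed curve `γ : [0, 1] → ℂ \ {0}`
(the value `0` is assigned to all other functions). -/
def windingIndex (γ : ℝ → ℂ) : ℤ :=
  if h : ∃ n, HasWindingIndex γ n then h.choose else 0

theorem HasWindingIndex.windingIndex_eq {γ : ℝ → ℂ} (hγ : ContinuousOn γ (Icc 0 1))
    (h0 : ∀ x ∈ Icc (0 : ℝ) 1, γ x ≠ 0) (hc : γ 0 = γ 1) {n : ℤ} (h : HasWindingIndex γ n) :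
    windingIndex γ = n := by
  have hex : ∃ n, HasWindingIndex γ n := ⟨n, h⟩
  rw [windingIndex, dif_pos hex]
  exact (existsUnique_hasWindingIndex hγ h0 hc).unique hex.choose_spec h

/-- The class `M(r₁, r₂)` (used for `1 > r₁ ≥ r₂ ≥ 0`): holomorphic maps from `annulus r₁` to
`annulus r₂` that preserve the index of the origin with respect to every closed curve. -/
structure ClassM (r₁ r₂ : ℝ) (ψ : ℂ → ℂ) : Prop where
  mapsTo : MapsTo ψ (annulus r₁) (annulus r₂)
  holomorphic : DifferentiableOn ℂ ψ (annulus r₁)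
  index_comp : ∀ γ : ℝ → ℂ, ContinuousOn γ (Icc 0 1) → MapsTo γ (Icc 0 1) (annulus r₁) →
    γ 0 = γ 1 → windingIndex (ψ ∘ γ) = windingIndex γ

end

/-! Through `exp`, a degree-one map `f` between annuli of inner radii `r₁ ≥ r₂` lifts to a
holomorphic `F` on a strip such that `ζ - F ζ` is `2πi`-periodic, hence a Laurent series with
coefficients `aₙ` in `z = exp ζ`. The alternatives (a), (b), (c) serve only to give degree one:
under (c) by testing on a circle, under (a) or (b) because the degree is locally constant along a
family containing the identity.

Since `f` stays in the target annulus, the real part of `ζ - F ζ` lies between `log |z|` and, if `r₂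
> 0`, `log |z| - log r₂`. A one-sided bound controls the Fourier coefficients of a real function by
the gap between its mean and the bound. Letting `|z|` tend to `1` and to `r₁` bounds every
nonconstant coefficient by `c = Re a₀` and a number `A` of order `r₁ log (r₁ / r₂)`, with a
substitute for small or zero `r₂`. Harnack's inequality bounds `c` by the displacement at one point
plus `A`, and estimates for `ω` bound `A` by the change of `ω`. The outcome is
`exists_norm_sub_le_mul`: `|f w - w| ≤ C (|f w₀ - w₀| + ω(r₁) - ω(r₂))`, with `C` uniform on compact
parts.

This is applied to `f = φ u t`, `w₀ = φ 0 u z₀` and `w = φ s u z`. A second use of Harnack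
(`exists_innerPart_image`) confines all the points `φ s u z` to one compact part, because the
trajectory of `z₀` is so confined. The right-hand side then consists of increments of two functions
of class `AC^d`, which supplies the `k` of EF3. -/

open Filter Topology

/-! ### Laurent coefficients of periodic functions on a strip. -/

/-- The preimage of an annulus under the exponential map, a vertical strip. -/
def logStrip (r : ℝ) : Set ℂ := {ζ | r < Real.exp ζ.re ∧ Real.exp ζ.re < 1}

theorem exp_mem_annulus_iff {r : ℝ} {ζ : ℂ} : Complex.exp ζ ∈ annulus r ↔ ζ ∈ logStrip r := by
  simp [annulus, logStrip, Complex.norm_exp]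

theorem isOpen_logStrip (r : ℝ) : IsOpen (logStrip r) :=
  have h : Continuous fun ζ : ℂ => Real.exp ζ.re := by fun_prop
  (isOpen_lt continuous_const h).inter (isOpen_lt h continuous_const)

theorem convex_logStrip (r : ℝ) : Convex ℝ (logStrip r) := by
  have h : logStrip r = Complex.re ⁻¹' {x | r < Real.exp x ∧ Real.exp x < 1} := rfl
  rw [h]
  have : Set.OrdConnected {x : ℝ | r < Real.exp x ∧ Real.exp x < 1} :=
    ⟨fun x hx y hy z hz => ⟨hx.1.trans_le (Real.exp_le_exp.2 hz.1),
      (Real.exp_le_exp.2 hz.2).trans_lt hy.2⟩⟩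
  exact this.convex.is_linear_preimage Complex.reLm.isLinear

theorem mem_logStrip_add_mul_I {r x : ℝ} (hx : r < Real.exp x) (hx' : Real.exp x < 1) (y : ℝ) :
    (x + y * Complex.I : ℂ) ∈ logStrip r := by
  simpa [logStrip, hx] using hx'

theorem add_two_pi_I_mem_logStrip {r : ℝ} {ζ : ℂ} (h : ζ ∈ logStrip r) :
    ζ + 2 * Real.pi * Complex.I ∈ logStrip r := by
  simpa [logStrip] using h

/-- The `n`-th Laurent coefficient of a `2πi`-periodic function, read off on the line `Re ζ = x`. -/
noncomputable def laurentCoeff (G : ℂ → ℂ) (x : ℝ) (n : ℤ) : ℂ :=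
  (1 / (2 * Real.pi) : ℂ) * ∫ θ in (0 : ℝ)..2 * Real.pi,
    Complex.exp (-n * (x + θ * Complex.I)) * G (x + θ * Complex.I)

/-- Cauchy's theorem on a rectangle of height `2π`: the horizontal sides cancel by periodicity. -/
theorem laurentCoeff_eq_of_periodic {r : ℝ} {G : ℂ → ℂ} (hG : DifferentiableOn ℂ G (logStrip r))
    (hper : ∀ ζ ∈ logStrip r, G (ζ + 2 * Real.pi * Complex.I) = G ζ) {x y : ℝ}
    (hx : r < Real.exp x) (hx' : Real.exp x < 1) (hy : r < Real.exp y) (hy' : Real.exp y < 1)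
    (n : ℤ) : laurentCoeff G x n = laurentCoeff G y n := by
  have key := Complex.integral_boundary_rect_eq_zero_of_differentiableOn
    (fun ζ => Complex.exp (-n * ζ) * G ζ) x (y + (2 * Real.pi : ℝ) * Complex.I) ?_
  · simp only [Complex.ofReal_re, Complex.ofReal_im, Complex.add_re, Complex.mul_re, Complex.I_re,
      mul_zero, Complex.I_im, mul_one, sub_self, add_zero, Complex.add_im, Complex.mul_im, zero_add,
      Complex.ofReal_zero, zero_mul] at key
    have hsides : (∫ t in x..y, Complex.exp (-n * t) * G t) =
        ∫ t in x..y, Complex.exp (-n * (t + (2 * Real.pi : ℝ) * Complex.I)) *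
          G (t + (2 * Real.pi : ℝ) * Complex.I) := by
      refine intervalIntegral.integral_congr fun t ht => ?_
      have hmem : (t : ℂ) ∈ logStrip r := by
        rcases le_total x y with h | h
        · rw [uIcc_of_le h] at ht
          exact ⟨hx.trans_le (by simpa using ht.1),
            (Real.exp_le_exp.2 (by simpa using ht.2)).trans_lt hy'⟩
        · rw [uIcc_of_ge h] at ht
          exact ⟨hy.trans_le (by simpa using ht.1),
            (Real.exp_le_exp.2 (by simpa using ht.2)).trans_lt hx'⟩
      have h1 : G (t + (2 * Real.pi : ℝ) * Complex.I) = G t := by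
        rw [← hper _ hmem]; push_cast; rfl
      rw [h1]
      congr 1
      rw [Complex.exp_eq_exp_iff_exists_int]
      exact ⟨n, by push_cast; ring⟩
    rw [hsides, sub_self, zero_add, sub_eq_zero] at key
    have := mul_left_cancel₀ (by simp : Complex.I ≠ 0) key
    rw [laurentCoeff, laurentCoeff, this]
  · refine DifferentiableOn.mul (by fun_prop) (hG.mono fun ζ hζ => ?_)
    have h1 := hζ.1
    simp only [Complex.ofReal_re, Complex.add_re, Complex.mul_re, Complex.I_re, mul_zero,
      Complex.ofReal_im, Complex.I_im, mul_one, sub_self, add_zero, mem_preimage] at h1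
    rcases le_total x y with h | h
    · rw [uIcc_of_le h] at h1
      exact ⟨hx.trans_le (by simpa using h1.1),
        (Real.exp_le_exp.2 (by simpa using h1.2)).trans_lt hy'⟩
    · rw [uIcc_of_ge h] at h1
      exact ⟨hy.trans_le (by simpa using h1.1),
        (Real.exp_le_exp.2 (by simpa using h1.2)).trans_lt hx'⟩

/-- On a vertical line this is a Fourier series. Summability is left as a hypothesis because it
follows later from the coefficient bounds. -/
theorem hasSum_laurentCoeff {r : ℝ} {G : ℂ → ℂ} (hG : DifferentiableOn ℂ G (logStrip r))
    (hper : ∀ ζ ∈ logStrip r, G (ζ + 2 * Real.pi * Complex.I) = G ζ) {x : ℝ}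
    (hx : r < Real.exp x) (hx' : Real.exp x < 1) (y : ℝ)
    (hs : Summable fun n : ℤ => laurentCoeff G x n * Complex.exp (n * x)) :
    HasSum (fun n : ℤ => laurentCoeff G x n * Complex.exp (n * (x + y * Complex.I)))
      (G (x + y * Complex.I)) := by
  have : Fact (0 < 2 * Real.pi) := ⟨Real.two_pi_pos⟩
  have hcont : Continuous fun θ : ℝ => G (x + θ * Complex.I) :=
    hG.continuousOn.comp_continuous (by fun_prop) fun θ => mem_logStrip_add_mul_I hx hx' θ
  have hp : Function.Periodic (fun θ : ℝ => G (x + θ * Complex.I)) (2 * Real.pi) := by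
    intro θ
    have := hper _ (mem_logStrip_add_mul_I hx hx' θ)
    simp only
    rw [← this]
    congr 1
    push_cast
    ring
  let g : C(AddCircle (2 * Real.pi), ℂ) := ⟨hp.lift, continuous_coinduced_dom.mpr hcont⟩
  have hcoef : ∀ n : ℤ, fourierCoeff g n = laurentCoeff G x n * Complex.exp (n * x) := by
    intro n
    rw [fourierCoeff_eq_intervalIntegral g n 0, laurentCoeff, mul_assoc,
      ← intervalIntegral.integral_mul_const, zero_add, Complex.real_smul]
    push_cast
    congr 1
    refine intervalIntegral.integral_congr fun θ _ => ?_
    have hgθ : g θ = G (x + θ * Complex.I) := rfl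
    simp only [hgθ, fourier_coe_apply, smul_eq_mul]
    rw [mul_right_comm (Complex.exp (-n * _)), ← Complex.exp_add]
    congr 2
    have : (Real.pi : ℂ) ≠ 0 := by simp [Real.pi_ne_zero]
    push_cast
    field_simp
    ring
  have := has_pointwise_sum_fourier_series_of_summable (f := g)
    (by rw [funext hcoef]; exact hs) y
  have hgy : g y = G (x + y * Complex.I) := rfl
  rw [hgy] at this
  convert this using 1
  funext n
  rw [hcoef n, fourier_coe_apply, smul_eq_mul, mul_assoc, ← Complex.exp_add]
  congr 2
  have : (Real.pi : ℂ) ≠ 0 := by simp [Real.pi_ne_zero]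
  push_cast
  field_simp

/-- The sum is the `n`-th Fourier integral of `2 Re g`. Subtracting the constant `2κ` does not
change it, as `n ≠ 0`, and makes the function nonnegative, so that its `L¹` norm is its integral. -/
theorem norm_integral_add_conj_le {g : ℝ → ℂ} (hg : Continuous g) {κ : ℝ} (hκ : ∀ θ, κ ≤ (g θ).re)
    {n : ℤ} (hn : n ≠ 0) :
    ‖(∫ θ in (0 : ℝ)..2 * Real.pi, Complex.exp (-n * (θ * Complex.I)) * g θ) +
      (starRingEnd ℂ) (∫ θ in (0 : ℝ)..2 * Real.pi, Complex.exp (n * (θ * Complex.I)) * g θ)‖ ≤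
      2 * ((∫ θ in (0 : ℝ)..2 * Real.pi, g θ).re - 2 * Real.pi * κ) := by
  have hconj : (starRingEnd ℂ) (∫ θ in (0 : ℝ)..2 * Real.pi,
      Complex.exp (n * (θ * Complex.I)) * g θ) =
      ∫ θ in (0 : ℝ)..2 * Real.pi, Complex.exp (-n * (θ * Complex.I)) * (starRingEnd ℂ) (g θ) := by
    rw [← intervalIntegral.intervalIntegral_conj]
    refine intervalIntegral.integral_congr fun θ _ => ?_
    simp [← Complex.exp_conj]
  have hzero : ∫ θ in (0 : ℝ)..2 * Real.pi, Complex.exp (-n * (θ * Complex.I)) * (2 * κ : ℂ) = 0 := by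
    rw [intervalIntegral.integral_mul_const]
    have h1 : ∀ θ : ℝ, Complex.exp (-n * (θ * Complex.I)) = Complex.exp ((-n * Complex.I) * θ) := by
      intro θ; congr 1; ring
    simp_rw [h1]
    rw [integral_exp_mul_complex (by simpa using hn)]
    have : Complex.exp (-n * Complex.I * (2 * Real.pi : ℝ)) = 1 := by
      rw [Complex.exp_eq_one_iff]; exact ⟨-n, by push_cast; ring⟩
    rw [this]; simp
  rw [hconj, ← intervalIntegral.integral_add
    (Continuous.intervalIntegrable (by fun_prop) _ _)
    (Continuous.intervalIntegrable (by fun_prop) _ _), ← sub_zero (∫ θ in _.._, _), ← hzero,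
    ← intervalIntegral.integral_sub (Continuous.intervalIntegrable (by fun_prop) _ _)
    (Continuous.intervalIntegrable (by fun_prop) _ _)]
  refine (intervalIntegral.norm_integral_le_integral_norm Real.two_pi_pos.le).trans ?_
  have h2 : ∀ θ : ℝ, ‖Complex.exp (-n * (θ * Complex.I)) * g θ +
      Complex.exp (-n * (θ * Complex.I)) * (starRingEnd ℂ) (g θ) -
      Complex.exp (-n * (θ * Complex.I)) * (2 * κ)‖ = 2 * (g θ).re - 2 * κ := by
    intro θ
    rw [← mul_add, ← mul_sub, norm_mul, Complex.add_conj, Complex.norm_exp]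
    have : (2 * (g θ).re : ℝ) - (2 * κ : ℂ) = ((2 * (g θ).re - 2 * κ : ℝ) : ℂ) := by push_cast; ring
    rw [this, Complex.norm_real, Real.norm_of_nonneg (by linarith [hκ θ])]
    simp
  have hre : (∫ θ in (0 : ℝ)..2 * Real.pi, g θ).re = ∫ θ in (0 : ℝ)..2 * Real.pi, (g θ).re :=
    (Complex.reCLM.intervalIntegral_comp_comm (hg.intervalIntegrable _ _)).symm
  simp_rw [h2]
  rw [intervalIntegral.integral_sub (Continuous.intervalIntegrable (by fun_prop) _ _)
    (Continuous.intervalIntegrable (by fun_prop) _ _), intervalIntegral.integral_const_mul, hre,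
    intervalIntegral.integral_const]
  simp only [sub_zero, smul_eq_mul]
  linarith

theorem norm_laurentCoeff_add_conj_le {r : ℝ} {G : ℂ → ℂ} (hG : DifferentiableOn ℂ G (logStrip r))
    {x κ : ℝ} (hx : r < Real.exp x) (hx' : Real.exp x < 1)
    (hκ : ∀ θ : ℝ, κ ≤ (G (x + θ * Complex.I)).re) {n : ℤ} (hn : n ≠ 0) :
    ‖laurentCoeff G x n * Complex.exp (n * x) +
      (starRingEnd ℂ) (laurentCoeff G x (-n) * Complex.exp (-n * x))‖ ≤
      2 * ((laurentCoeff G x 0).re - κ) := by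
  have hcont : Continuous fun θ : ℝ => G (x + θ * Complex.I) :=
    hG.continuousOn.comp_continuous (by fun_prop) fun θ => mem_logStrip_add_mul_I hx hx' θ
  have h := norm_integral_add_conj_le hcont hκ hn
  have hm : ∀ m : ℤ, laurentCoeff G x m * Complex.exp (m * x) = (1 / (2 * Real.pi) : ℝ) *
      ∫ θ in (0 : ℝ)..2 * Real.pi, Complex.exp (-m * (θ * Complex.I)) * G (x + θ * Complex.I) := by
    intro m
    rw [laurentCoeff, mul_assoc, ← intervalIntegral.integral_mul_const]
    push_cast
    congr 1
    refine intervalIntegral.integral_congr fun θ _ => ?_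
    rw [mul_right_comm, ← Complex.exp_add]
    congr 2
    ring
  have h0 : (laurentCoeff G x 0).re = 1 / (2 * Real.pi) *
      (∫ θ in (0 : ℝ)..2 * Real.pi, G (x + θ * Complex.I)).re := by
    have := hm 0
    simp only [Int.cast_zero, zero_mul, Complex.exp_zero, mul_one, neg_zero, one_mul] at this
    rw [this, Complex.re_ofReal_mul]
  have hneg := hm (-n)
  rw [Int.cast_neg] at hneg
  rw [hm, hneg, map_mul, Complex.conj_ofReal, ← mul_add, norm_mul, Complex.norm_real,
    Real.norm_of_nonneg (by positivity), h0]
  simp only [neg_neg]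
  calc _ ≤ 1 / (2 * Real.pi) * (2 * ((∫ θ in (0 : ℝ)..2 * Real.pi,
        G (x + θ * Complex.I)).re - 2 * Real.pi * κ)) := by gcongr
    _ = _ := by
      generalize (∫ θ in (0 : ℝ)..2 * Real.pi, G (x + θ * Complex.I)).re = J
      field_simp

theorem laurentCoeff_neg_left (G : ℂ → ℂ) (x : ℝ) (n : ℤ) :
    laurentCoeff (fun ζ => -G ζ) x n = -laurentCoeff G x n := by
  simp [laurentCoeff]

/-- One coefficient family serves all radii, so the one-sided bounds on different circles can be
combined. The upper bound is the lower one for `-G`. -/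
theorem exists_laurent_coefficients {r : ℝ} (hr : 0 ≤ r) (hr1 : r < 1) {G : ℂ → ℂ}
    (hG : DifferentiableOn ℂ G (logStrip r))
    (hper : ∀ ζ ∈ logStrip r, G (ζ + 2 * Real.pi * Complex.I) = G ζ) :
    ∃ a : ℤ → ℂ,
      (∀ ζ ∈ logStrip r, (Summable fun n : ℤ => a n * Complex.exp ζ ^ n) →
        HasSum (fun n : ℤ => a n * Complex.exp ζ ^ n) (G ζ)) ∧
      (∀ ρ κ : ℝ, r < ρ → ρ < 1 → (∀ ζ : ℂ, Real.exp ζ.re = ρ → κ ≤ (G ζ).re) → ∀ n : ℤ, n ≠ 0 →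
        ‖a n * (ρ : ℂ) ^ n + (starRingEnd ℂ) (a (-n)) * (ρ : ℂ) ^ (-n)‖ ≤ 2 * ((a 0).re - κ)) ∧
      (∀ ρ κ : ℝ, r < ρ → ρ < 1 → (∀ ζ : ℂ, Real.exp ζ.re = ρ → (G ζ).re ≤ κ) → ∀ n : ℤ, n ≠ 0 →
        ‖a n * (ρ : ℂ) ^ n + (starRingEnd ℂ) (a (-n)) * (ρ : ℂ) ^ (-n)‖ ≤
          2 * (κ - (a 0).re)) := by
  have hx₀ : Real.exp (Real.log ((r + 1) / 2)) = (r + 1) / 2 := Real.exp_log (by linarith)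
  set x₀ := Real.log ((r + 1) / 2) with hx₀def
  have ha : ∀ x : ℝ, r < Real.exp x → Real.exp x < 1 → ∀ n,
      laurentCoeff G x n = laurentCoeff G x₀ n := fun x hx hx' n =>
    laurentCoeff_eq_of_periodic hG hper hx hx' (by rw [hx₀]; linarith [hr1])
      (by rw [hx₀]; linarith [hr1]) n
  have hpow : ∀ (x : ℝ) (n : ℤ), Complex.exp (n * x) = (Real.exp x : ℂ) ^ n := by
    intro x n
    rw [Complex.exp_int_mul, Complex.ofReal_exp]
  have hline : ∀ (G' : ℂ → ℂ), DifferentiableOn ℂ G' (logStrip r) →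
      ∀ ρ κ : ℝ, r < ρ → ρ < 1 → (∀ ζ : ℂ, Real.exp ζ.re = ρ → κ ≤ (G' ζ).re) → ∀ n : ℤ, n ≠ 0 →
        ‖laurentCoeff G' (Real.log ρ) n * (ρ : ℂ) ^ n +
          (starRingEnd ℂ) (laurentCoeff G' (Real.log ρ) (-n)) * (ρ : ℂ) ^ (-n)‖ ≤
          2 * ((laurentCoeff G' (Real.log ρ) 0).re - κ) := by
    intro G' hG' ρ κ h1 h2 hκ n hn
    have hρ : Real.exp (Real.log ρ) = ρ := Real.exp_log (hr.trans_lt h1)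
    have := norm_laurentCoeff_add_conj_le hG' (x := Real.log ρ) (κ := κ) (by rwa [hρ])
      (by rwa [hρ]) (fun θ => hκ _ (by simpa using hρ)) hn
    rw [map_mul, hpow, ← Int.cast_neg, hpow, hρ, map_zpow₀, Complex.conj_ofReal] at this
    exact this
  refine ⟨laurentCoeff G x₀, ?_, ?_, ?_⟩
  · intro ζ hζ hs
    have hb : ∀ n : ℤ, Complex.exp (n * (ζ.re + ζ.im * Complex.I)) = Complex.exp ζ ^ n := by
      intro n
      rw [Complex.re_add_im, Complex.exp_int_mul]
    have := hasSum_laurentCoeff hG hper hζ.1 hζ.2 ζ.im ?_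
    · simp_rw [hb, Complex.re_add_im, ha _ hζ.1 hζ.2] at this
      exact this
    · refine Summable.of_norm_bounded hs.norm fun n => le_of_eq ?_
      rw [ha _ hζ.1 hζ.2, norm_mul, norm_mul, hpow, norm_zpow, norm_zpow, Complex.norm_exp]
      simp
  · intro ρ κ h1 h2 hκ n hn
    have hρ : Real.exp (Real.log ρ) = ρ := Real.exp_log (hr.trans_lt h1)
    have h := hline G hG ρ κ h1 h2 hκ n hn
    simp only [ha (Real.log ρ) (by rwa [hρ]) (by rwa [hρ])] at h
    exact h
  · intro ρ κ h1 h2 hκ n hn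
    have hρ : Real.exp (Real.log ρ) = ρ := Real.exp_log (hr.trans_lt h1)
    have h := hline (fun ζ => -G ζ) hG.fun_neg ρ (-κ) h1 h2 (fun ζ hζ => by simpa using hκ ζ hζ) n hn
    simp only [laurentCoeff_neg_left, ha (Real.log ρ) (by rwa [hρ]) (by rwa [hρ])] at h
    rw [map_neg, neg_mul, neg_mul, ← neg_add, norm_neg, Complex.neg_re] at h
    linarith

/-! ### Boundary limits of coefficient bounds, and Harnack's inequality. -/

/-- The outer boundary values control the symmetrised coefficients. -/
theorem norm_add_conj_le_of_forall_radius {r c : ℝ} (hr1 : r < 1) {a b : ℂ} {k : ℕ}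
    (h : ∀ ρ : ℝ, r < ρ → ρ < 1 →
      ‖a * (ρ : ℂ) ^ k + (starRingEnd ℂ) b * ((ρ : ℂ) ^ k)⁻¹‖ ≤ 2 * (c - Real.log ρ)) :
    ‖a + (starRingEnd ℂ) b‖ ≤ 2 * c := by
  have h1 : Tendsto (fun ρ : ℝ => ‖a * (ρ : ℂ) ^ k + (starRingEnd ℂ) b * ((ρ : ℂ) ^ k)⁻¹‖)
      (𝓝[<] 1) (𝓝 ‖a * ((1 : ℝ) : ℂ) ^ k + (starRingEnd ℂ) b * (((1 : ℝ) : ℂ) ^ k)⁻¹‖) := by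
    refine tendsto_nhdsWithin_of_tendsto_nhds (ContinuousAt.tendsto ?_)
    refine ContinuousAt.norm (ContinuousAt.add (by fun_prop) (ContinuousAt.mul (by fun_prop) ?_))
    exact ContinuousAt.inv₀ (by fun_prop) (by simp)
  have h2 : Tendsto (fun ρ : ℝ => 2 * (c - Real.log ρ)) (𝓝[<] 1) (𝓝 (2 * (c - Real.log 1))) := by
    refine tendsto_nhdsWithin_of_tendsto_nhds (ContinuousAt.tendsto ?_)
    exact continuousAt_const.mul (continuousAt_const.sub (Real.continuousAt_log one_ne_zero))
  have := le_of_tendsto_of_tendsto h1 h2 (by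
    filter_upwards [Ioo_mem_nhdsLT hr1] with ρ hρ using h ρ hρ.1 hρ.2)
  simpa using this

/-- The inner boundary values control the coefficients of negative index. -/
theorem norm_mul_le_of_forall_radius {r c : ℝ} (hr : 0 ≤ r) (hr1 : r < 1) {a b : ℂ} {k : ℕ}
    (hk : k ≠ 0) (hab : ‖a + (starRingEnd ℂ) b‖ ≤ 2 * c) {M β : ℝ → ℝ} (hβ : ContinuousAt β r)
    (hMβ : ∀ ρ, r < ρ → ρ < 1 → ρ * (M ρ + c) = β ρ)
    (h : ∀ ρ : ℝ, r < ρ → ρ < 1 →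
      ‖a * (ρ : ℂ) ^ k + (starRingEnd ℂ) b * ((ρ : ℂ) ^ k)⁻¹‖ ≤ 2 * M ρ) :
    ‖b‖ * (1 - r ^ 2) ≤ 2 * r ^ (k - 1) * β r := by
  have hc : 0 ≤ c := by linarith [norm_nonneg (a + (starRingEnd ℂ) b)]
  have h1 : Tendsto (fun ρ : ℝ => ‖b‖ * (1 - ρ ^ 2)) (𝓝[>] r) (𝓝 (‖b‖ * (1 - r ^ 2))) :=
    tendsto_nhdsWithin_of_tendsto_nhds (ContinuousAt.tendsto (by fun_prop))
  have h2 : Tendsto (fun ρ : ℝ => 2 * ρ ^ (k - 1) * β ρ) (𝓝[>] r)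
      (𝓝 (2 * r ^ (k - 1) * β r)) :=
    tendsto_nhdsWithin_of_tendsto_nhds (ContinuousAt.tendsto (by fun_prop))
  refine le_of_tendsto_of_tendsto h1 h2 ?_
  filter_upwards [Ioo_mem_nhdsGT hr1] with ρ hρ
  have hρ0 : 0 < ρ := hr.trans_lt hρ.1
  have hpk : 0 < ρ ^ k := pow_pos hρ0 k
  have hpk1 : ρ ^ k ≤ 1 := pow_le_one₀ hρ0.le hρ.2.le
  have hρc : (ρ : ℂ) ^ k ≠ 0 := by exact_mod_cast hpk.ne'
  -- The combination of the bounds at radii `ρ` and `1` that eliminates `a`.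
  have hid : (starRingEnd ℂ) b * ((1 - (ρ ^ k) ^ 2 : ℝ) : ℂ) =
      (ρ : ℂ) ^ k * (a * (ρ : ℂ) ^ k + (starRingEnd ℂ) b * ((ρ : ℂ) ^ k)⁻¹) -
        ((ρ : ℂ) ^ k) ^ 2 * (a + (starRingEnd ℂ) b) := by
    push_cast
    field_simp
    ring
  have hn : ‖b‖ * (1 - (ρ ^ k) ^ 2) ≤ ρ ^ k * (2 * M ρ) + (ρ ^ k) ^ 2 * (2 * c) := by
    have h3 : ‖(starRingEnd ℂ) b * ((1 - (ρ ^ k) ^ 2 : ℝ) : ℂ)‖ = ‖b‖ * (1 - (ρ ^ k) ^ 2) := by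
      rw [norm_mul, Complex.norm_real, Real.norm_of_nonneg (by nlinarith), RCLike.norm_conj]
    rw [← h3, hid]
    refine (norm_sub_le _ _).trans ?_
    have hnρ : ‖(ρ : ℂ) ^ k‖ = ρ ^ k := by
      rw [norm_pow, Complex.norm_real, Real.norm_of_nonneg hρ0.le]
    rw [norm_mul, norm_mul, norm_pow _ 2, hnρ]
    gcongr
    exact h ρ hρ.1 hρ.2
  calc ‖b‖ * (1 - ρ ^ 2) ≤ ‖b‖ * (1 - (ρ ^ k) ^ 2) := by
        have : ρ ^ k ≤ ρ := pow_le_of_le_one hρ0.le hρ.2.le hk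
        gcongr
    _ ≤ ρ ^ k * (2 * M ρ) + (ρ ^ k) ^ 2 * (2 * c) := hn
    _ ≤ ρ ^ k * (2 * M ρ) + ρ ^ k * (2 * c) := by
        gcongr
        nlinarith
    _ = 2 * ρ ^ (k - 1) * (ρ * (M ρ + c)) := by
        obtain ⟨j, rfl⟩ := Nat.exists_eq_succ_of_ne_zero hk
        simp only [Nat.succ_eq_add_one, Nat.add_sub_cancel, pow_succ]
        ring
    _ = _ := by rw [hMβ ρ hρ.1 hρ.2]

/-- **Harnack's inequality** for the real part of a holomorphic function on a disk. -/
theorem re_le_mul_re_of_forall_re_pos {h : ℂ → ℂ} {x y : ℂ} {R : ℝ}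
    (hd : DifferentiableOn ℂ h (Metric.ball x R)) (hpos : ∀ z ∈ Metric.ball x R, 0 < (h z).re)
    (hy : y ∈ Metric.ball x R) :
    (R - dist y x) * (h y).re ≤ (R + dist y x) * (h x).re ∧
      (R - dist y x) * (h x).re ≤ (R + dist y x) * (h y).re := by
  have hR : 0 < R := dist_nonneg.trans_lt hy
  have hx : x ∈ Metric.ball x R := Metric.mem_ball_self hR
  have hne : ∀ z ∈ Metric.ball x R, h z + (starRingEnd ℂ) (h x) ≠ 0 := by
    intro z hz h0
    have := congrArg Complex.re h0
    simp only [Complex.add_re, Complex.conj_re, Complex.zero_re] at this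
    linarith [hpos z hz, hpos x hx]
  have hsq : ∀ z : ℂ, ‖h z - h x‖ ^ 2 = ((h z).re - (h x).re) ^ 2 + ((h z).im - (h x).im) ^ 2 := by
    intro z
    rw [← Complex.normSq_eq_norm_sq, Complex.normSq_apply]; simp; ring
  have hsq' : ∀ z : ℂ, ‖h z + (starRingEnd ℂ) (h x)‖ ^ 2 =
      ((h z).re + (h x).re) ^ 2 + ((h z).im - (h x).im) ^ 2 := by
    intro z
    rw [← Complex.normSq_eq_norm_sq, Complex.normSq_apply]; simp; ring
  -- Schwarz lemma for the Cayley transform of `h` that sends `h x` to `0` and the right half-plane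
  -- into the unit disk.
  have hS := Complex.dist_le_div_mul_dist_of_mapsTo_ball (R₂ := 1)
    (f := fun z => (h z - h x) / (h z + (starRingEnd ℂ) (h x))) (c := x) (R₁ := R)
    ((hd.sub_const _).fun_div (hd.add_const _) hne) (fun z hz => by
      simp only [sub_self, zero_div, mem_closedBall_zero_iff, norm_div]
      refine div_le_one_of_le₀ ?_ (norm_nonneg _)
      rw [← sq_le_sq₀ (norm_nonneg _) (norm_nonneg _), hsq, hsq']
      nlinarith [hpos z hz, hpos x hx]) hy
  simp only [sub_self, zero_div, dist_zero_right, norm_div] at hS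
  rw [div_le_iff₀ (norm_pos_iff.2 (hne y hy)), one_div_mul_eq_div] at hS
  set d := dist y x with hd'
  have hd0 : 0 ≤ d := dist_nonneg
  have hdR : d < R := hy
  have h1 : R * ‖h y - h x‖ ≤ d * ‖h y + (starRingEnd ℂ) (h x)‖ := by
    rw [div_mul_eq_mul_div, le_div_iff₀ hR] at hS
    linarith
  have h2 : R ^ 2 * ‖h y - h x‖ ^ 2 ≤ d ^ 2 * ‖h y + (starRingEnd ℂ) (h x)‖ ^ 2 := by
    rw [← mul_pow, ← mul_pow]
    exact pow_le_pow_left₀ (by positivity) h1 2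
  rw [hsq, hsq'] at h2
  have h3 : (R * ((h y).re - (h x).re)) ^ 2 ≤ (d * ((h y).re + (h x).re)) ^ 2 := by
    have : d ^ 2 * ((h y).im - (h x).im) ^ 2 ≤ R ^ 2 * ((h y).im - (h x).im) ^ 2 := by
      gcongr
    nlinarith
  have h4 := abs_le.1 (abs_le_of_sq_le_sq h3 (mul_nonneg hd0 (by linarith [hpos y hy, hpos x hx])))
  constructor <;> nlinarith [h4.1, h4.2]

/-! ### Consequences of the coefficient bounds. -/

/-- Coefficient bounds for the Laurent series of `ζ - F ζ`, `F` being the lift of a map of annuli. -/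
structure LaurentBounds (r c A : ℝ) (a : ℤ → ℂ) : Prop where
  nonneg : 0 ≤ A
  re_zero : (a 0).re = c
  sym : ∀ k : ℕ, ‖a (k + 1) + (starRingEnd ℂ) (a (-(k + 1)))‖ ≤ 2 * c
  neg : ∀ k : ℕ, ‖a (-(k + 1))‖ ≤ A * r ^ k

namespace LaurentBounds
variable {r c A : ℝ} {a : ℤ → ℂ}

theorem c_nonneg (h : LaurentBounds r c A a) : 0 ≤ c := by
  linarith [h.sym 0, norm_nonneg (a ((0 : ℕ) + 1) + (starRingEnd ℂ) (a (-((0 : ℕ) + 1))))]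

theorem pos (h : LaurentBounds r c A a) (hr : 0 ≤ r) (hr1 : r < 1) (k : ℕ) :
    ‖a (k + 1)‖ ≤ 2 * c + A := by
  have h1 : a (k + 1) = (a (k + 1) + (starRingEnd ℂ) (a (-(k + 1)))) -
      (starRingEnd ℂ) (a (-(k + 1))) := by ring
  rw [h1]
  refine (norm_sub_le _ _).trans (add_le_add (h.sym k) ?_)
  rw [RCLike.norm_conj]
  exact (h.neg k).trans (mul_le_of_le_one_right h.nonneg (pow_le_one₀ hr hr1.le))

theorem norm_neg_term_le (h : LaurentBounds r c A a) {z : ℂ} (hz : r < ‖z‖) (hr : 0 ≤ r) (k : ℕ) :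
    ‖a (-(k + 1)) * z ^ (-(k + 1) : ℤ)‖ ≤ A / ‖z‖ * (r / ‖z‖) ^ k := by
  have hz0 : 0 < ‖z‖ := hr.trans_lt hz
  rw [norm_mul, norm_zpow, zpow_neg]
  have : ‖z‖ ^ ((k : ℤ) + 1) = ‖z‖ ^ (k + 1) := by exact_mod_cast zpow_natCast ‖z‖ (k + 1)
  rw [this]
  calc _ ≤ (A * r ^ k) * (‖z‖ ^ (k + 1))⁻¹ := by gcongr; exact h.neg k
    _ = _ := by rw [div_pow, pow_succ]; field_simp

theorem norm_pos_term_le (h : LaurentBounds r c A a) {z : ℂ} (hr : 0 ≤ r) (hr1 : r < 1) (k : ℕ) :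
    ‖a (k + 1) * z ^ (k + 1 : ℤ)‖ ≤ (2 * c + A) * ‖z‖ * ‖z‖ ^ k := by
  have : z ^ ((k : ℤ) + 1) = z ^ (k + 1) := by exact_mod_cast zpow_natCast z (k + 1)
  rw [norm_mul, this, norm_pow, pow_succ]
  calc _ ≤ (2 * c + A) * (‖z‖ ^ k * ‖z‖) := by gcongr; exact h.pos hr hr1 k
    _ = _ := by ring

theorem hasSum_neg_bound {z : ℂ} (hz : r < ‖z‖) (hr : 0 ≤ r) :
    HasSum (fun k : ℕ => A / ‖z‖ * (r / ‖z‖) ^ k) (A / (‖z‖ - r)) := by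
  have hz0 : 0 < ‖z‖ := hr.trans_lt hz
  have := (hasSum_geometric_of_lt_one (r := r / ‖z‖) (by positivity)
    ((div_lt_one hz0).2 hz)).mul_left (A / ‖z‖)
  have h1 : A / (‖z‖ - r) = A / ‖z‖ * (1 - r / ‖z‖)⁻¹ := by
    have h2 : 1 - r / ‖z‖ = (‖z‖ - r) / ‖z‖ := by field_simp
    rw [h2, inv_div]
    field_simp
  rw [h1]
  exact this

theorem hasSum_pos_bound {z : ℂ} (hz : ‖z‖ < 1) (K : ℝ) :
    HasSum (fun k : ℕ => K * ‖z‖ * ‖z‖ ^ k) (K * ‖z‖ / (1 - ‖z‖)) := by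
  have := (hasSum_geometric_of_lt_one (norm_nonneg z) hz).mul_left (K * ‖z‖)
  rwa [← div_eq_mul_inv] at this

theorem summable (h : LaurentBounds r c A a) (hr : 0 ≤ r) {z : ℂ} (hz : r < ‖z‖) (hz1 : ‖z‖ < 1) :
    Summable fun n : ℤ => a n * z ^ n := by
  have hp : Summable fun k : ℕ => a (k + 1) * z ^ (k + 1 : ℤ) :=
    Summable.of_norm_bounded (hasSum_pos_bound hz1 _).summable
      (h.norm_pos_term_le hr (hz.trans hz1))
  have hn : Summable fun k : ℕ => a (-(k + 1)) * z ^ (-(k + 1) : ℤ) :=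
    Summable.of_norm_bounded (hasSum_neg_bound hz hr).summable (h.norm_neg_term_le hz hr)
  refine Summable.of_nat_of_neg_add_one (f := fun n : ℤ => a n * z ^ n) ?_ hn
  rw [← summable_nat_add_iff 1]
  exact_mod_cast hp

theorem hasSum_sub (h : LaurentBounds r c A a) (hr : 0 ≤ r) {z g : ℂ} (hz : r < ‖z‖)
    (hz1 : ‖z‖ < 1)
    (hg : (Summable fun n : ℤ => a n * z ^ n) → HasSum (fun n : ℤ => a n * z ^ n) g) :
    HasSum (fun k : ℕ => a (k + 1) * z ^ (k + 1 : ℤ) + a (-(k + 1)) * z ^ (-(k + 1) : ℤ))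
      (g - a 0) := by
  have h1 := (hg (h.summable hr hz hz1)).nat_add_neg
  rw [← hasSum_nat_add_iff' 1] at h1
  have e : g - a 0 = g + a 0 * z ^ (0 : ℤ) -
      ∑ i ∈ Finset.range 1, (a i * z ^ (i : ℤ) + a (-i) * z ^ (-i : ℤ)) := by
    simp
  rw [e]
  push_cast at h1 ⊢
  exact h1

/-- Comparison with two geometric series: the oscillation of `g` about `a 0` is linear in `c` and
`A`. -/
theorem norm_sub_le (h : LaurentBounds r c A a) (hr : 0 ≤ r) {z g : ℂ} (hz : r < ‖z‖)
    (hz1 : ‖z‖ < 1)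
    (hg : (Summable fun n : ℤ => a n * z ^ n) → HasSum (fun n : ℤ => a n * z ^ n) g) :
    ‖g - a 0‖ ≤ (2 * c + A) * ‖z‖ / (1 - ‖z‖) + A / (‖z‖ - r) :=
  (h.hasSum_sub hr hz hz1 hg).norm_le_of_bounded
    ((hasSum_pos_bound hz1 _).add (hasSum_neg_bound hz hr)) fun k =>
      (norm_add_le _ _).trans (add_le_add (h.norm_pos_term_le hr (hz.trans hz1) k)
        (h.norm_neg_term_le hz hr k))

end LaurentBounds

/-! ### Bounding the mean by the value at one point. -/

/-- The holomorphic function on the unit disk whose real part has the same boundary values as the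
Laurent series with coefficients `a` (up to the constant term). -/
noncomputable def reflectedSeries (a : ℤ → ℂ) (z : ℂ) : ℂ :=
  ∑' k : ℕ, (a (k + 1) + (starRingEnd ℂ) (a (-(k + 1)))) * z ^ (k + 1)

namespace LaurentBounds
variable {r c A : ℝ} {a : ℤ → ℂ}

theorem norm_reflected_term_le (h : LaurentBounds r c A a) (z : ℂ) (k : ℕ) :
    ‖(a (k + 1) + (starRingEnd ℂ) (a (-(k + 1)))) * z ^ (k + 1)‖ ≤ 2 * c * ‖z‖ * ‖z‖ ^ k := by
  rw [norm_mul, norm_pow, pow_succ]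
  calc _ ≤ (2 * c) * (‖z‖ ^ k * ‖z‖) := by gcongr; exact h.sym k
    _ = _ := by ring

theorem hasSum_reflectedSeries (h : LaurentBounds r c A a) {z : ℂ} (hz1 : ‖z‖ < 1) :
    HasSum (fun k : ℕ => (a (k + 1) + (starRingEnd ℂ) (a (-(k + 1)))) * z ^ (k + 1))
      (reflectedSeries a z) :=
  (Summable.of_norm_bounded (hasSum_pos_bound hz1 _).summable
    (h.norm_reflected_term_le z)).hasSum

theorem differentiableOn_reflectedSeries (h : LaurentBounds r c A a) {R : ℝ} (hR0 : 0 < R)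
    (hR : R < 1) : DifferentiableOn ℂ (reflectedSeries a) (Metric.ball 0 R) := by
  have hR' : ‖(R : ℂ)‖ = R := by rw [Complex.norm_real, Real.norm_of_nonneg hR0.le]
  refine Complex.differentiableOn_tsum_of_summable_norm
    (hasSum_pos_bound (z := (R : ℂ)) (by rwa [hR']) (2 * c)).summable
    (fun k => by fun_prop) Metric.isOpen_ball fun k w hw => ?_
  refine (h.norm_reflected_term_le w k).trans ?_
  have := h.c_nonneg
  have hw' : ‖w‖ ≤ R := by simpa using (mem_ball_zero_iff.1 hw).le
  rw [hR']
  gcongr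

/-- On the unit circle `w⁻¹` is the conjugate of `w`, so moving the negative powers across leaves
the real part unchanged there. Inside, the termwise errors sum to a quantity that tends to `0` as
`‖z‖ → 1`. -/
theorem abs_re_sub_reflectedSeries_le (h : LaurentBounds r c A a) (hr : 0 ≤ r) {z g : ℂ}
    (hz : r < ‖z‖) (hz1 : ‖z‖ < 1)
    (hg : (Summable fun n : ℤ => a n * z ^ n) → HasSum (fun n : ℤ => a n * z ^ n) g) :
    |g.re - c - (reflectedSeries a z).re| ≤ A / (‖z‖ - r) - A * ‖z‖ / (1 - r * ‖z‖) := by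
  have hz0 : 0 < ‖z‖ := hr.trans_lt hz
  have hs := Complex.hasSum_re ((h.hasSum_sub hr hz hz1 hg).sub (h.hasSum_reflectedSeries hz1))
  have hb : HasSum (fun k : ℕ => A * ‖z‖ * (r * ‖z‖) ^ k) (A * ‖z‖ / (1 - r * ‖z‖)) := by
    have := (hasSum_geometric_of_lt_one (r := r * ‖z‖) (by positivity)
      (by nlinarith)).mul_left (A * ‖z‖)
    rwa [← div_eq_mul_inv] at this
  have := hs.norm_le_of_bounded ((hasSum_neg_bound (A := A) hz hr).sub hb) fun k => ?_
  · simpa [h.re_zero] using this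
  · have h1 : z ^ ((k : ℤ) + 1) = z ^ (k + 1) := by exact_mod_cast zpow_natCast z (k + 1)
    have h2 : z ^ (-((k : ℤ) + 1)) = (z ^ (k + 1))⁻¹ := by rw [zpow_neg, h1]
    rw [h1, h2]
    set b := a (-((k : ℤ) + 1))
    set w := z ^ (k + 1)
    have hw : 0 < ‖w‖ := by simp only [w, norm_pow]; positivity
    have hw1 : ‖w‖ ≤ 1 := by simp only [w, norm_pow]; exact pow_le_one₀ hz0.le hz1.le
    have hw0 : w ≠ 0 := norm_pos_iff.1 hw
    have h3 : (a (k + 1) * w + b * w⁻¹ - (a (k + 1) + (starRingEnd ℂ) b) * w).re =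
        (b * (w⁻¹ - (starRingEnd ℂ) w)).re := by
      have : ((starRingEnd ℂ) b * w).re = (b * (starRingEnd ℂ) w).re := by
        rw [← Complex.conj_re, map_mul, Complex.conj_conj]
      rw [mul_sub, Complex.sub_re (b * w⁻¹), ← this]
      simp only [add_mul, Complex.sub_re, Complex.add_re]
      ring
    have h4 : w⁻¹ - (starRingEnd ℂ) w = (starRingEnd ℂ) w * (((‖w‖ ^ 2)⁻¹ - 1 : ℝ) : ℂ) := by
      rw [Complex.inv_def, Complex.normSq_eq_norm_sq]
      push_cast
      ring
    have h5 : ‖w⁻¹ - (starRingEnd ℂ) w‖ = ‖w‖⁻¹ - ‖w‖ := by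
      rw [h4, norm_mul, RCLike.norm_conj, Complex.norm_real, Real.norm_of_nonneg]
      · field_simp
      · rw [sub_nonneg]; exact (one_le_inv₀ (by positivity)).2 (pow_le_one₀ hw.le hw1)
    rw [h3]
    refine (Complex.abs_re_le_norm _).trans ?_
    rw [norm_mul, h5]
    have h6 : 0 ≤ ‖w‖⁻¹ - ‖w‖ := by rw [← h5]; positivity
    calc _ ≤ A * r ^ k * (‖w‖⁻¹ - ‖w‖) := by gcongr; exact h.neg k
      _ = _ := by
        have hwz : ‖w‖ = ‖z‖ * ‖z‖ ^ k := by
          simp only [w, norm_pow]; rw [pow_succ']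
        rw [hwz, div_pow, mul_pow]
        field_simp

/-- Unlike `G`, the reflected series is holomorphic on the whole disk, so the lower bound near the
unit circle propagates inwards by the maximum principle for `exp (-reflectedSeries a)`. -/
theorem neg_le_re_reflectedSeries (h : LaurentBounds r c A a) (hr : 0 ≤ r) (hr1 : r < 1)
    {G : ℂ → ℂ} (hre : ∀ z : ℂ, r < ‖z‖ → ‖z‖ < 1 → Real.log ‖z‖ ≤ (G z).re)
    (hG : ∀ z : ℂ, r < ‖z‖ → ‖z‖ < 1 →
      (Summable fun n : ℤ => a n * z ^ n) → HasSum (fun n : ℤ => a n * z ^ n) (G z))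
    {z : ℂ} (hz1 : ‖z‖ < 1) : -c ≤ (reflectedSeries a z).re := by
  have key : ∀ ρ : ℝ, r < ρ → ‖z‖ < ρ → ρ < 1 →
      Real.log ρ - c - (A / (ρ - r) - A * ρ / (1 - r * ρ)) ≤ (reflectedSeries a z).re := by
    intro ρ h1 h2 h3
    set m := Real.log ρ - c - (A / (ρ - r) - A * ρ / (1 - r * ρ))
    have hρ0 : 0 < ρ := hr.trans_lt h1
    obtain ⟨R, hR1, hR2⟩ := exists_between h3
    have hcl : closure (Metric.ball (0 : ℂ) ρ) = Metric.closedBall 0 ρ := closure_ball _ hρ0.ne'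
    have hd : DiffContOnCl ℂ (fun z => Complex.exp (-reflectedSeries a z)) (Metric.ball 0 ρ) := by
      refine DifferentiableOn.diffContOnCl ?_
      rw [hcl]
      exact ((h.differentiableOn_reflectedSeries (hρ0.trans hR1) hR2).mono
        (Metric.closedBall_subset_ball hR1)).fun_neg.cexp
    have hb := Complex.norm_le_of_forall_mem_frontier_norm_le Metric.isBounded_ball hd
      (C := Real.exp (-m)) (fun w hw => ?_) (z := z)
      (subset_closure (by simpa using h2))
    · rw [Complex.norm_exp, Real.exp_le_exp, Complex.neg_re] at hb
      linarith
    · rw [frontier_ball _ hρ0.ne', mem_sphere_zero_iff_norm] at hw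
      rw [Complex.norm_exp, Real.exp_le_exp, Complex.neg_re, neg_le_neg_iff]
      have h4 := h.abs_re_sub_reflectedSeries_le hr (by rwa [hw]) (by rwa [hw])
        (hG w (by rwa [hw]) (by rwa [hw]))
      have h5 := hre w (by rwa [hw]) (by rwa [hw])
      rw [hw] at h4 h5
      have := (abs_le.1 h4).2
      simp only [m]
      linarith
  have hlim : Tendsto (fun ρ : ℝ => Real.log ρ - c - (A / (ρ - r) - A * ρ / (1 - r * ρ)))
      (𝓝[<] 1) (𝓝 (Real.log 1 - c - (A / (1 - r) - A * 1 / (1 - r * 1)))) := by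
    refine tendsto_nhdsWithin_of_tendsto_nhds (ContinuousAt.tendsto ?_)
    refine ((Real.continuousAt_log one_ne_zero).sub continuousAt_const).sub (ContinuousAt.sub ?_ ?_)
    · exact continuousAt_const.div (by fun_prop) (by linarith)
    · exact ContinuousAt.div (by fun_prop) (by fun_prop) (by linarith)
  have := le_of_tendsto hlim (b := (reflectedSeries a z).re) (by
    filter_upwards [Ioo_mem_nhdsLT (max_lt hr1 hz1)] with ρ hρ using
      key ρ ((le_max_left _ _).trans_lt hρ.1) ((le_max_right _ _).trans_lt hρ.1) hρ.2)
  simpa using this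

/-- Harnack's inequality between `0` and `z` for `reflectedSeries a + c`, whose real part is
nonnegative and whose value at `0` is `c`. -/
theorem c_le (h : LaurentBounds r c A a) (hr : 0 ≤ r) (hr1 : r < 1)
    {G : ℂ → ℂ} (hre : ∀ z : ℂ, r < ‖z‖ → ‖z‖ < 1 → Real.log ‖z‖ ≤ (G z).re)
    (hG : ∀ z : ℂ, r < ‖z‖ → ‖z‖ < 1 →
      (Summable fun n : ℤ => a n * z ^ n) → HasSum (fun n : ℤ => a n * z ^ n) (G z))
    {z : ℂ} (hz : r < ‖z‖) (hz1 : ‖z‖ < 1) :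
    (1 - ‖z‖) * c ≤ 2 * ((G z).re + A / (‖z‖ - r)) := by
  have hz0 : 0 < ‖z‖ := hr.trans_lt hz
  have hH : ∀ w : ℂ, ‖w‖ < 1 → -c ≤ (reflectedSeries a w).re :=
    fun w hw => h.neg_le_re_reflectedSeries hr hr1 hre hG hw
  have h0 : reflectedSeries a 0 = 0 := by simp [reflectedSeries]
  have hX : 0 ≤ (reflectedSeries a z).re + c := by linarith [hH z hz1]
  -- The shift by `ε` gives the strict positivity that Harnack's inequality requires. Later `ε = 1 -
  -- R` tends to `0`.
  have hharn : ∀ R ε : ℝ, ‖z‖ < R → R < 1 → 0 < ε →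
      (R - ‖z‖) * (c + ε) ≤ (R + ‖z‖) * ((reflectedSeries a z).re + c + ε) := by
    intro R ε h1 h2 hε
    have := (re_le_mul_re_of_forall_re_pos (h := fun w => reflectedSeries a w + (c + ε : ℝ))
      (x := 0) (y := z) ((h.differentiableOn_reflectedSeries (hz0.trans h1) h2).add_const _)
      (fun w hw => by
        have := hH w ((mem_ball_zero_iff.1 hw).trans h2)
        rw [Complex.add_re, Complex.ofReal_re]
        linarith) (mem_ball_zero_iff.2 h1)).2
    simp only [dist_zero_right, h0, zero_add, Complex.add_re, Complex.ofReal_re] at this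
    linarith
  have h1 : (1 - ‖z‖) * c ≤ (1 + ‖z‖) * ((reflectedSeries a z).re + c) := by
    have hl : Tendsto (fun R : ℝ => (R - ‖z‖) * (c + (1 - R))) (𝓝[<] 1)
        (𝓝 ((1 - ‖z‖) * (c + (1 - 1)))) :=
      tendsto_nhdsWithin_of_tendsto_nhds (ContinuousAt.tendsto (by fun_prop))
    have hrr : Tendsto (fun R : ℝ => (R + ‖z‖) * ((reflectedSeries a z).re + c + (1 - R))) (𝓝[<] 1)
        (𝓝 ((1 + ‖z‖) * ((reflectedSeries a z).re + c + (1 - 1)))) :=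
      tendsto_nhdsWithin_of_tendsto_nhds (ContinuousAt.tendsto (by fun_prop))
    have := le_of_tendsto_of_tendsto hl hrr (by
      filter_upwards [Ioo_mem_nhdsLT hz1] with R hR using hharn R (1 - R) hR.1 hR.2 (by linarith [hR.2]))
    simpa using this
  have h2 := (abs_le.1 (h.abs_re_sub_reflectedSeries_le hr hz hz1 (hG z hz hz1))).1
  have h3 : 0 ≤ A * ‖z‖ / (1 - r * ‖z‖) := by
    have := h.nonneg
    have : 0 < 1 - r * ‖z‖ := by nlinarith
    positivity
  have h4 : (reflectedSeries a z).re + c ≤ (G z).re + A / (‖z‖ - r) := by linarith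
  nlinarith

end LaurentBounds

/-! ### Logarithmic lifts and their degree. -/

theorem eqOn_of_exp_eq {X : Type*} [TopologicalSpace X] {s : Set X} (hs : IsPreconnected s)
    {L M : X → ℂ} (hL : ContinuousOn L s) (hM : ContinuousOn M s)
    (h : ∀ x ∈ s, Complex.exp (L x) = Complex.exp (M x)) {a : X} (ha : a ∈ s) (haLM : L a = M a) :
    EqOn L M s :=
  Complex.isCoveringMap_exp.eqOn_of_comp_eqOn hs hL hM
    (fun x hx => Subtype.ext (h x hx)) ha haLM

/-- `F` is a holomorphic lift of `f` with respect to the exponential map, and the values of `F` at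
`ζ` and `ζ + 2πi` differ by `2πin`. -/
structure IsLogLift (r : ℝ) (f F : ℂ → ℂ) (n : ℤ) : Prop where
  differentiableOn : DifferentiableOn ℂ F (logStrip r)
  exp_eq : ∀ ζ ∈ logStrip r, Complex.exp (F ζ) = f (Complex.exp ζ)
  period : ∀ ζ ∈ logStrip r, F (ζ + 2 * Real.pi * Complex.I) = F ζ + n * (2 * Real.pi * Complex.I)

/-- The strip is convex, so the nonvanishing function `f ∘ exp` has a continuous logarithm there. It
agrees locally with a branch of `Complex.log` up to a constant, hence is holomorphic, and its
increment over a period is constant by uniqueness of lifts. -/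
theorem exists_isLogLift {r : ℝ} (hr : 0 ≤ r) (hr1 : r < 1) {f : ℂ → ℂ}
    (hf : DifferentiableOn ℂ f (annulus r)) (h0 : ∀ z ∈ annulus r, f z ≠ 0) :
    ∃ F n, IsLogLift r f F n := by
  have hmem : ((Real.log ((r + 1) / 2) : ℝ) : ℂ) ∈ logStrip r := by
    simp only [logStrip, mem_ofPred_eq, Complex.ofReal_re,
      Real.exp_log (by linarith : 0 < (r + 1) / 2)]
    constructor <;> linarith
  have hsc : IsSimplyConnected (logStrip r) := by
    have := (convex_logStrip r).contractibleSpace ⟨_, hmem⟩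
    exact (inferInstance : SimplyConnectedSpace (logStrip r))
  have hg : DifferentiableOn ℂ (fun ζ => f (Complex.exp ζ)) (logStrip r) :=
    hf.comp Complex.differentiable_exp.differentiableOn fun ζ hζ => exp_mem_annulus_iff.2 hζ
  have hg0 : ∀ ζ ∈ logStrip r, f (Complex.exp ζ) ≠ 0 := fun ζ hζ => h0 _ (exp_mem_annulus_iff.2 hζ)
  obtain ⟨F, hFc, hF⟩ := Complex.exists_continuousOn_eqOn_exp_comp hsc (isOpen_logStrip r)
    hg.continuousOn (by rintro ⟨ζ, hζ, h⟩; exact hg0 ζ hζ h)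
  have hFe : ∀ ζ ∈ logStrip r, Complex.exp (F ζ) = f (Complex.exp ζ) := fun ζ hζ => hF hζ
  have hshift : ContinuousOn (fun ζ => F (ζ + 2 * Real.pi * Complex.I)) (logStrip r) :=
    hFc.comp (by fun_prop) fun ζ hζ => add_two_pi_I_mem_logStrip hζ
  have hexpper : ∀ ζ : ℂ, Complex.exp (ζ + 2 * Real.pi * Complex.I) = Complex.exp ζ :=
    Complex.exp_periodic
  obtain ⟨n, hn⟩ := Complex.exp_eq_exp_iff_exists_int.1
    (show Complex.exp (F ((Real.log ((r + 1) / 2) : ℝ) + 2 * Real.pi * Complex.I)) =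
      Complex.exp (F (Real.log ((r + 1) / 2) : ℝ)) by
        rw [hFe _ (add_two_pi_I_mem_logStrip hmem), hFe _ hmem, hexpper])
  refine ⟨F, n, ?_, hFe, ?_⟩
  · intro ζ₀ hζ₀
    refine DifferentiableAt.differentiableWithinAt ?_
    have hnhds := (isOpen_logStrip r).mem_nhds hζ₀
    have hd : DifferentiableAt ℂ
        (fun ζ => Complex.log (f (Complex.exp ζ) / f (Complex.exp ζ₀)) + F ζ₀) ζ₀ := by
      refine (((hg.differentiableAt hnhds).div_const _).clog ?_).add_const _
      rw [div_self (hg0 _ hζ₀)]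
      exact Complex.one_mem_slitPlane
    refine hd.congr_of_eventuallyEq ?_
    have hev : ∀ᶠ ζ in 𝓝 ζ₀, ‖F ζ - F ζ₀‖ < Real.pi := by
      have : ContinuousAt (fun ζ => ‖F ζ - F ζ₀‖) ζ₀ :=
        ((hFc.continuousAt hnhds).sub continuousAt_const).norm
      exact this.eventually_lt continuousAt_const (by simpa using Real.pi_pos)
    filter_upwards [hev, hnhds] with ζ h1 h2
    rw [← hFe ζ h2, ← hFe ζ₀ hζ₀, ← Complex.exp_sub, Complex.log_exp]
    · ring
    · linarith [(abs_le.1 (Complex.abs_im_le_norm (F ζ - F ζ₀))).1]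
    · linarith [(abs_le.1 (Complex.abs_im_le_norm (F ζ - F ζ₀))).2]
  · refine eqOn_of_exp_eq (convex_logStrip r).isPreconnected hshift (hFc.add continuousOn_const)
      (fun ζ hζ => ?_) hmem hn
    rw [hFe _ (add_two_pi_I_mem_logStrip hζ), hexpper, Complex.exp_add,
      Complex.exp_int_mul_two_pi_mul_I, mul_one, hFe _ hζ]

theorem IsLogLift.continuous_line {r : ℝ} {f F : ℂ → ℂ} {n : ℤ} (h : IsLogLift r f F n) {ρ : ℝ}
    (h0 : 0 < ρ) (h1 : r < ρ) (h2 : ρ < 1) :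
    Continuous fun x : ℝ => F (Real.log ρ + x * Complex.I) := by
  refine h.differentiableOn.continuousOn.comp_continuous (by fun_prop) fun x => ?_
  exact mem_logStrip_add_mul_I (by rwa [Real.exp_log h0]) (by rwa [Real.exp_log h0]) x

/-- Rouché's argument: on the circle `f / g` stays in the unit disk about `1`, where the principal
logarithm is continuous, so `F - G` has no increment over a period. -/
theorem IsLogLift.degree_eq_of_norm_sub_lt {r : ℝ} {f g F G : ℂ → ℂ} {m n : ℤ}
    (hF : IsLogLift r f F m) (hG : IsLogLift r g G n) {ρ : ℝ} (h0 : 0 < ρ) (h1 : r < ρ)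
    (h2 : ρ < 1) (hfg : ∀ z : ℂ, ‖z‖ = ρ → ‖f z - g z‖ < ‖g z‖) : m = n := by
  have hmem : ∀ x : ℝ, (Real.log ρ + x * Complex.I : ℂ) ∈ logStrip r := fun x =>
    mem_logStrip_add_mul_I (by rwa [Real.exp_log h0]) (by rwa [Real.exp_log h0]) x
  have hn : ∀ x : ℝ, ‖Complex.exp (Real.log ρ + x * Complex.I)‖ = ρ := by
    intro x
    simp [Complex.norm_exp, Real.exp_log h0]
  set e : ℝ → ℂ := fun x => F (Real.log ρ + x * Complex.I) - G (Real.log ρ + x * Complex.I) with he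
  have hec : Continuous e := (hF.continuous_line h0 h1 h2).sub (hG.continuous_line h0 h1 h2)
  have hslit : ∀ x, Complex.exp (e x) ∈ Complex.slitPlane := by
    intro x
    set z := Complex.exp (Real.log ρ + x * Complex.I) with hz
    have hq : Complex.exp (e x) = f z / g z := by
      rw [he, Complex.exp_sub, hF.exp_eq _ (hmem x), hG.exp_eq _ (hmem x)]
    have hlt := hfg z (hn x)
    have hg0 : g z ≠ 0 := fun h => by
      rw [h, norm_zero] at hlt
      exact absurd hlt (norm_nonneg _).not_gt
    have : Complex.exp (e x) = 1 + (f z - g z) / g z := by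
      rw [hq]
      field_simp
      ring
    rw [this]
    refine Complex.mem_slitPlane_of_norm_lt_one ?_
    rwa [norm_div, div_lt_one (norm_pos_iff.2 hg0)]
  have hlogc : Continuous fun x => Complex.log (Complex.exp (e x)) :=
    (Complex.continuous_exp.comp hec).clog hslit
  have hD := eqOn_of_exp_eq (s := univ) isPreconnected_univ
    (L := fun x => e x - Complex.log (Complex.exp (e x)))
    (M := fun _ => e 0 - Complex.log (Complex.exp (e 0))) (hec.sub hlogc).continuousOn
    continuousOn_const (fun x _ => by
      simp only [Complex.exp_sub, Complex.exp_log (Complex.exp_ne_zero _)]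
      rw [div_self (Complex.exp_ne_zero _), div_self (Complex.exp_ne_zero _)])
    (mem_univ 0) rfl
  have h2pi := hD (mem_univ (2 * Real.pi))
  have hper : e (2 * Real.pi) = e 0 + ((m - n : ℤ) : ℂ) * (2 * Real.pi * Complex.I) := by
    have hF' := hF.period _ (hmem 0)
    have hG' := hG.period _ (hmem 0)
    simp only [Complex.ofReal_zero, zero_mul, add_zero] at hF' hG'
    simp only [he, Complex.ofReal_mul, Complex.ofReal_ofNat, Complex.ofReal_zero, zero_mul,
      add_zero, hF', hG']
    push_cast
    ring
  simp only [hper] at h2pi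
  rw [Complex.exp_add (e 0), Complex.exp_int_mul_two_pi_mul_I, mul_one] at h2pi
  have h3 : ((m - n : ℤ) : ℂ) * (2 * Real.pi * Complex.I) = 0 := by linear_combination h2pi
  rcases mul_eq_zero.1 h3 with h | h
  · have : m - n = 0 := by exact_mod_cast h
    omega
  · exact absurd h Complex.two_pi_I_ne_zero

/-- The circle of radius `ρ` traversed once has index `1`, and the index of its image is the degree
of the lift. -/
theorem ClassM.exists_isLogLift {r₁ r₂ : ℝ} (hr : 0 ≤ r₁) (hr1 : r₁ < 1) (hr₂ : 0 ≤ r₂) {f : ℂ → ℂ}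
    (hf : ClassM r₁ r₂ f) : ∃ F, IsLogLift r₁ f F 1 := by
  have hne : ∀ z ∈ annulus r₁, f z ≠ 0 := fun z hz h => by
    have := (hf.mapsTo hz).1
    rw [h, norm_zero] at this
    linarith
  obtain ⟨F, n, hF⟩ := _root_.exists_isLogLift hr hr1 hf.holomorphic hne
  have h0 : 0 < (r₁ + 1) / 2 := by linarith
  have h1 : r₁ < (r₁ + 1) / 2 := by linarith
  have h2 : (r₁ + 1) / 2 < 1 := by linarith
  set ρ := (r₁ + 1) / 2
  have hmem : ∀ x : ℝ, (Real.log ρ + x * Complex.I : ℂ) ∈ logStrip r₁ := fun x =>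
    mem_logStrip_add_mul_I (by rwa [Real.exp_log h0]) (by rwa [Real.exp_log h0]) x
  let L : ℝ → ℂ := fun x => Real.log ρ + (2 * Real.pi * x : ℝ) * Complex.I
  let γ : ℝ → ℂ := fun x => Complex.exp (L x)
  have hL : Continuous L := by fun_prop
  have hγ : Continuous γ := by fun_prop
  have hγm : ∀ x, γ x ∈ annulus r₁ := fun x => exp_mem_annulus_iff.2 (hmem _)
  have hγc : γ 0 = γ 1 := by
    have := Complex.exp_periodic (L 0)
    simp only [γ]
    rw [← this]
    congr 1
    simp [L]
  have hi1 : windingIndex γ = 1 := by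
    refine HasWindingIndex.windingIndex_eq hγ.continuousOn (fun x _ => Complex.exp_ne_zero _) hγc
      ⟨L, hL.continuousOn, fun x _ => rfl, ?_⟩
    simp [L]
  have hin : windingIndex (f ∘ γ) = n := by
    refine HasWindingIndex.windingIndex_eq
      (hf.holomorphic.continuousOn.comp hγ.continuousOn fun x _ => hγm x)
      (fun x _ => hne _ (hγm x)) (congrArg f hγc)
      ⟨fun x => F (L x), ?_, fun x _ => hF.exp_eq _ (hmem _), ?_⟩
    · exact ((hF.continuous_line h0 h1 h2).comp (by fun_prop : Continuous fun x : ℝ =>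
        2 * Real.pi * x)).continuousOn
    · have := hF.period _ (hmem 0)
      simp only [Complex.ofReal_zero, zero_mul, add_zero] at this
      simp only [L, mul_one, mul_zero, Complex.ofReal_mul, Complex.ofReal_one, Complex.ofReal_ofNat,
        Complex.ofReal_zero, zero_mul, add_zero, this]
      ring
  have := hf.index_comp γ hγ.continuousOn (fun x _ => hγm x) hγc
  rw [hin, hi1] at this
  exact ⟨F, this ▸ hF⟩

theorem isLogLift_id {r : ℝ} {f : ℂ → ℂ} (hf : ∀ z ∈ annulus r, f z = z) :
    IsLogLift r f id 1 :=
  ⟨differentiableOn_id, fun ζ hζ => (hf _ (exp_mem_annulus_iff.2 hζ)).symm, fun ζ _ => by simp⟩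

theorem isOpen_annulus (r : ℝ) : IsOpen (annulus r) :=
  (isOpen_lt continuous_const continuous_norm).inter (isOpen_lt continuous_norm continuous_const)

/-- Pointwise continuity in `t` becomes uniform on compact sets: the maps are bounded by `1`, so the
Schwarz lemma gives a Lipschitz constant `2 / η` near each point, independent of `t`. -/
theorem eventually_forall_norm_sub_lt {r : ℝ} {T : Set ℝ} {f : ℝ → ℂ → ℂ}
    (hd : ∀ t ∈ T, DifferentiableOn ℂ (f t) (annulus r))
    (h1 : ∀ t ∈ T, ∀ z ∈ annulus r, ‖f t z‖ < 1) (h0 : ∀ t ∈ T, ∀ z ∈ annulus r, f t z ≠ 0)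
    (hc : ∀ z ∈ annulus r, ContinuousOn (fun t => f t z) T) {K : Set ℂ} (hK : IsCompact K)
    (hKr : K ⊆ annulus r) {t₀ : ℝ} (ht₀ : t₀ ∈ T) :
    ∀ᶠ t in 𝓝 t₀, ∀ z ∈ K, t ∈ T → ‖f t z - f t₀ z‖ < ‖f t₀ z‖ := by
  refine hK.eventually_forall_of_forall_eventually fun z₀ hz₀ => ?_
  obtain ⟨η, hη, hball⟩ := Metric.isOpen_iff.1 (isOpen_annulus r) z₀ (hKr hz₀)
  have hm : 0 < ‖f t₀ z₀‖ := norm_pos_iff.2 (h0 t₀ ht₀ z₀ (hKr hz₀))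
  set m := ‖f t₀ z₀‖
  have hlip : ∀ t ∈ T, ∀ z ∈ Metric.ball z₀ η, dist (f t z) (f t z₀) ≤ 2 / η * dist z z₀ := by
    intro t ht z hz
    refine Complex.dist_le_div_mul_dist_of_mapsTo_ball ((hd t ht).mono hball) (fun w hw => ?_) hz
    rw [mem_closedBall_iff_norm]
    linarith [norm_sub_le (f t w) (f t z₀), h1 t ht w (hball hw), h1 t ht z₀ (hKr hz₀)]
  have hev1 : ∀ᶠ t in 𝓝 t₀, t ∈ T → ‖f t z₀ - f t₀ z₀‖ < m / 8 := by
    have := (Metric.continuousWithinAt_iff'.1 (hc z₀ (hKr hz₀) t₀ ht₀)) (m / 8) (by positivity)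
    rw [eventually_nhdsWithin_iff] at this
    simpa only [dist_eq_norm] using this
  have hev2 : ∀ᶠ z in 𝓝 z₀, z ∈ Metric.ball z₀ (min η (η * m / 16)) :=
    Metric.ball_mem_nhds _ (by positivity)
  rw [nhds_prod_eq]
  filter_upwards [hev1.prod_mk hev2] with ⟨t, z⟩ ⟨ht1, hz⟩ ht
  simp only at ht1 hz ht ⊢
  have hzη : dist z z₀ < η := (Metric.mem_ball.1 hz).trans_le (min_le_left _ _)
  have hzm : 2 / η * dist z z₀ ≤ m / 8 := by
    have : dist z z₀ ≤ η * m / 16 := ((Metric.mem_ball.1 hz).trans_le (min_le_right _ _)).le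
    calc 2 / η * dist z z₀ ≤ 2 / η * (η * m / 16) := by gcongr
      _ = m / 8 := by field_simp; norm_num
  have e1 := (hlip t ht z hzη).trans hzm
  have e2 := (hlip t₀ ht₀ z hzη).trans hzm
  have e3 := ht1 ht
  rw [dist_eq_norm] at e1 e2
  have e4 : ‖f t z - f t₀ z‖ ≤ ‖f t z - f t z₀‖ + ‖f t z₀ - f t₀ z₀‖ + ‖f t₀ z - f t₀ z₀‖ := by
    have : f t z - f t₀ z = (f t z - f t z₀) + (f t z₀ - f t₀ z₀) - (f t₀ z - f t₀ z₀) := by ring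
    rw [this]
    exact (norm_sub_le _ _).trans (by gcongr; exact norm_add_le _ _)
  have e5 : m ≤ ‖f t₀ z‖ + ‖f t₀ z - f t₀ z₀‖ := by
    have := norm_sub_le (f t₀ z) (f t₀ z - f t₀ z₀)
    rwa [sub_sub_cancel] at this
  linarith

/-- The degree is locally constant in `t` by the Rouché argument, hence constant on `T`, and it is
`1` for the identity. -/
theorem exists_isLogLift_one_of_continuousOn {r : ℝ} (hr : 0 ≤ r) (hr1 : r < 1) {T : Set ℝ}
    (hT : IsPreconnected T) {f : ℝ → ℂ → ℂ}
    (hd : ∀ t ∈ T, DifferentiableOn ℂ (f t) (annulus r))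
    (h1 : ∀ t ∈ T, ∀ z ∈ annulus r, ‖f t z‖ < 1) (h0 : ∀ t ∈ T, ∀ z ∈ annulus r, f t z ≠ 0)
    (hc : ∀ z ∈ annulus r, ContinuousOn (fun t => f t z) T) {t₀ : ℝ} (ht₀ : t₀ ∈ T)
    (hid : ∀ z ∈ annulus r, f t₀ z = z) {t : ℝ} (ht : t ∈ T) : ∃ F, IsLogLift r (f t) F 1 := by
  have hex : ∀ t, ∃ n : ℤ, t ∈ T → ∃ F, IsLogLift r (f t) F n := by
    intro t
    by_cases ht : t ∈ T
    · obtain ⟨F, n, h⟩ := exists_isLogLift hr hr1 (hd t ht) (h0 t ht)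
      exact ⟨n, fun _ => ⟨F, h⟩⟩
    · exact ⟨0, fun h => absurd h ht⟩
  choose n hn using hex
  have p0 : 0 < (r + 1) / 2 := by linarith
  have p1 : r < (r + 1) / 2 := by linarith
  have p2 : (r + 1) / 2 < 1 := by linarith
  set ρ := (r + 1) / 2
  have hKr : Metric.sphere (0 : ℂ) ρ ⊆ annulus r := fun z hz => by
    rw [mem_sphere_zero_iff_norm] at hz
    exact ⟨by rwa [hz], by rwa [hz]⟩
  have hnc : ContinuousOn n T := by
    intro t₁ ht₁
    refine ContinuousWithinAt.congr_of_eventuallyEq (continuousWithinAt_const (b := n t₁)) ?_ rfl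
    rw [EventuallyEq, eventually_nhdsWithin_iff]
    filter_upwards [eventually_forall_norm_sub_lt hd h1 h0 hc (isCompact_sphere 0 ρ) hKr ht₁] with
      t ht htT
    obtain ⟨F, hF⟩ := hn t htT
    obtain ⟨G, hG⟩ := hn t₁ ht₁
    exact hF.degree_eq_of_norm_sub_lt hG p0 p1 p2 fun z hz =>
      ht z (mem_sphere_zero_iff_norm.2 hz) htT
  have hconst := hT.constant hnc ht ht₀
  obtain ⟨F₀, hF₀⟩ := hn t₀ ht₀
  have h1' : n t₀ = 1 := hF₀.degree_eq_of_norm_sub_lt (isLogLift_id hid) p0 p1 p2 fun z hz => by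
    rw [sub_self, norm_zero, norm_pos_iff]
    exact h0 t₀ ht₀ z (hKr (mem_sphere_zero_iff_norm.2 hz))
  rw [h1'] at hconst
  exact hconst ▸ hn t ht

/-! ### Elementary estimates for `ω`. -/

theorem annulusOmega_of_pos {r : ℝ} (h : 0 < r) : annulusOmega r = -Real.pi / Real.log r := by
  simp [annulusOmega, h.ne']

theorem annulusOmega_pos {r : ℝ} (h : 0 < r) (h1 : r < 1) : 0 < annulusOmega r := by
  rw [annulusOmega_of_pos h]
  exact div_pos_of_neg_of_neg (by linarith [Real.pi_pos]) (Real.log_neg h h1)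

theorem log_eq_neg_pi_div_annulusOmega {r : ℝ} (h : 0 < r) (h1 : r < 1) :
    Real.log r = -Real.pi / annulusOmega r := by
  have := (Real.log_neg h h1).ne
  have := Real.pi_pos.ne'
  rw [annulusOmega_of_pos h]
  field_simp

/-- From `|x log x| < 1` at `x = √r` one gets `r (log r)² < 4 < π²`. -/
theorem le_annulusOmega_sq {r : ℝ} (h : 0 < r) (h1 : r < 1) : r ≤ annulusOmega r ^ 2 := by
  have hlog := Real.log_neg h h1
  rw [annulusOmega_of_pos h, div_pow, neg_sq, le_div_iff₀ (by have := hlog.ne; positivity)]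
  have hs : |Real.log (√r) * √r| < 1 :=
    Real.abs_log_mul_self_lt _ (Real.sqrt_pos.2 h) (Real.sqrt_le_one.2 h1.le)
  have h2 : (Real.log √r * √r) ^ 2 < 1 := by
    rw [← sq_abs]
    exact pow_lt_one₀ (abs_nonneg _) hs two_ne_zero
  rw [Real.log_sqrt h.le, mul_pow, Real.sq_sqrt h.le] at h2
  nlinarith [Real.pi_gt_three]

theorem neg_mul_log_le {r : ℝ} (h : 0 < r) (h1 : r < 1) :
    -(r * Real.log r) ≤ Real.pi * annulusOmega r := by
  have h2 := le_annulusOmega_sq h h1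
  have h3 := annulusOmega_pos h h1
  rw [log_eq_neg_pi_div_annulusOmega h h1, neg_div, mul_neg, neg_neg, ← mul_div_assoc,
    div_le_iff₀ h3]
  nlinarith [Real.pi_pos]

/-- The difference of logarithms is `π (ω₁ - ω₂) / (ω₁ ω₂)`. The factor `r₁ ≤ ω₁²` cancels the
denominator up to `ω₁ / ω₂ ≤ 2`. -/
theorem mul_log_sub_log_le {r₁ r₂ : ℝ} (h₂ : 0 < r₂) (h₂₁ : r₂ < 1) (h₁ : 0 < r₁) (h1 : r₁ < 1)
    (hle : annulusOmega r₂ ≤ annulusOmega r₁) (h : annulusOmega r₁ ≤ 2 * annulusOmega r₂) :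
    r₁ * (Real.log r₁ - Real.log r₂) ≤
      2 * Real.pi * (annulusOmega r₁ - annulusOmega r₂) := by
  have h3 := le_annulusOmega_sq h₁ h1
  have p1 := annulusOmega_pos h₁ h1
  have p2 := annulusOmega_pos h₂ h₂₁
  rw [log_eq_neg_pi_div_annulusOmega h₁ h1, log_eq_neg_pi_div_annulusOmega h₂ h₂₁]
  set x := annulusOmega r₁
  set y := annulusOmega r₂
  have e : r₁ * (-Real.pi / x - -Real.pi / y) = Real.pi * (r₁ * (x - y)) / (x * y) := by
    field_simp
    ring
  rw [e, div_le_iff₀ (by positivity)]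
  have : r₁ * (x - y) ≤ 2 * (x - y) * (x * y) := by
    have : r₁ * (x - y) ≤ x ^ 2 * (x - y) := mul_le_mul_of_nonneg_right h3 (by linarith)
    have : x * (x * (x - y)) ≤ 2 * y * (x * (x - y)) :=
      mul_le_mul_of_nonneg_right h (mul_nonneg p1.le (by linarith))
    nlinarith
  nlinarith [Real.pi_pos]

/-! ### Coefficient bounds for lifts of maps of annuli. -/

namespace IsLogLift
variable {r₁ r₂ : ℝ} {f F : ℂ → ℂ} {n : ℤ}

theorem exp_re (h : IsLogLift r₁ f F n) {ζ : ℂ} (hζ : ζ ∈ logStrip r₁) :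
    Real.exp (F ζ).re = ‖f (Complex.exp ζ)‖ := by
  rw [← Complex.norm_exp, h.exp_eq ζ hζ]

theorem re_neg (h : IsLogLift r₁ f F n) (hf : MapsTo f (annulus r₁) (annulus r₂)) {ζ : ℂ}
    (hζ : ζ ∈ logStrip r₁) : (F ζ).re < 0 := by
  rw [← Real.exp_lt_one_iff, h.exp_re hζ]
  exact (hf (exp_mem_annulus_iff.2 hζ)).2

theorem log_lt_re (h : IsLogLift r₁ f F n) (hf : MapsTo f (annulus r₁) (annulus r₂))
    (hr₂ : 0 < r₂) {ζ : ℂ} (hζ : ζ ∈ logStrip r₁) : Real.log r₂ < (F ζ).re := by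
  rw [Real.log_lt_iff_lt_exp hr₂, h.exp_re hζ]
  exact (hf (exp_mem_annulus_iff.2 hζ)).1

theorem sub_const (h : IsLogLift r₁ f F n) (m : ℤ) :
    IsLogLift r₁ f (fun ζ => F ζ - m * (2 * Real.pi * Complex.I)) n where
  differentiableOn := h.differentiableOn.sub_const _
  exp_eq ζ hζ := by
    rw [Complex.exp_sub, Complex.exp_int_mul_two_pi_mul_I, div_one, h.exp_eq ζ hζ]
  period ζ hζ := by rw [h.period ζ hζ]; ring

/-- Two values of `A` come from the inner circle. The second uses `Re F > log r₂` there. The first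
reuses the bound `Re F < 0`, and so remains available when `r₂ = 0`. -/
theorem exists_laurentBounds (h : IsLogLift r₁ f F 1) (hf : MapsTo f (annulus r₁) (annulus r₂))
    (hr₁ : 0 ≤ r₁) (hr₁1 : r₁ < 1) (hr : r₂ ≤ r₁) :
    ∃ (a : ℤ → ℂ) (c : ℝ),
      (∀ ζ ∈ logStrip r₁, (Summable fun n : ℤ => a n * Complex.exp ζ ^ n) →
        HasSum (fun n : ℤ => a n * Complex.exp ζ ^ n) (ζ - F ζ)) ∧
      LaurentBounds r₁ c (2 * (r₁ * (2 * c - Real.log r₁)) / (1 - r₁ ^ 2)) a ∧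
      (0 < r₂ →
        LaurentBounds r₁ c (2 * (r₁ * (Real.log r₁ - Real.log r₂)) / (1 - r₁ ^ 2)) a) := by
  have hmem : ∀ {ρ : ℝ} {ζ : ℂ}, r₁ < ρ → ρ < 1 → Real.exp ζ.re = ρ → ζ ∈ logStrip r₁ :=
    fun h1 h2 h3 => ⟨by rwa [h3], by rwa [h3]⟩
  obtain ⟨a, ha, hlow, hup⟩ := exists_laurent_coefficients hr₁ hr₁1 (G := fun ζ => ζ - F ζ)
    (differentiableOn_id.sub h.differentiableOn) (fun ζ hζ => by
      rw [h.period ζ hζ]; push_cast; ring)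
  have hcast : ∀ (k : ℕ) (ρ : ℝ), a (k + 1) * (ρ : ℂ) ^ ((k : ℤ) + 1) +
      (starRingEnd ℂ) (a (-(k + 1))) * (ρ : ℂ) ^ (-((k : ℤ) + 1)) =
      a (k + 1) * (ρ : ℂ) ^ (k + 1) +
      (starRingEnd ℂ) (a (-(k + 1))) * ((ρ : ℂ) ^ (k + 1))⁻¹ := by
    intro k ρ
    have : (ρ : ℂ) ^ ((k : ℤ) + 1) = (ρ : ℂ) ^ (k + 1) := by exact_mod_cast zpow_natCast (ρ : ℂ) (k + 1)
    rw [zpow_neg, this]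
  have hlow' : ∀ (k : ℕ) (ρ : ℝ), r₁ < ρ → ρ < 1 → ‖a (k + 1) * (ρ : ℂ) ^ (k + 1) +
      (starRingEnd ℂ) (a (-(k + 1))) * ((ρ : ℂ) ^ (k + 1))⁻¹‖ ≤
      2 * ((a 0).re - Real.log ρ) := by
    intro k ρ h1 h2
    rw [← hcast]
    refine hlow ρ _ h1 h2 (fun ζ hζ => ?_) _ (by omega)
    have := h.re_neg hf (hmem h1 h2 hζ)
    rw [← hζ, Real.log_exp, Complex.sub_re]
    linarith
  have hsym : ∀ k : ℕ, ‖a (k + 1) + (starRingEnd ℂ) (a (-(k + 1)))‖ ≤ 2 * (a 0).re :=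
    fun k => norm_add_conj_le_of_forall_radius hr₁1 (hlow' k)
  have hc : 0 ≤ (a 0).re := by
    linarith [hsym 0, norm_nonneg (a ((0 : ℕ) + 1) + (starRingEnd ℂ) (a (-((0 : ℕ) + 1))))]
  have hden : 0 < 1 - r₁ ^ 2 := by nlinarith
  -- Continuity of `ρ log ρ` at `0` lets the limit `ρ → r₁` include the punctured disk `r₁ = 0`.
  have hml : Continuous fun ρ : ℝ => ρ * Real.log ρ := Real.continuous_mul_log
  refine ⟨a, (a 0).re, ha, ⟨?_, rfl, hsym, fun k => ?_⟩, fun hr₂ => ⟨?_, rfl, hsym, fun k => ?_⟩⟩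
  · have := Real.log_nonpos hr₁ hr₁1.le
    have : 0 ≤ 2 * (a 0).re - Real.log r₁ := by linarith
    positivity
  · have := norm_mul_le_of_forall_radius hr₁ hr₁1 (Nat.succ_ne_zero k) (hsym k)
      (M := fun ρ => (a 0).re - Real.log ρ) (β := fun ρ => 2 * (a 0).re * ρ - ρ * Real.log ρ)
      (Continuous.continuousAt (by fun_prop)) (fun ρ _ _ => by ring) (hlow' k)
    rw [div_mul_eq_mul_div, le_div_iff₀ hden]
    refine this.trans (le_of_eq ?_)
    simp only [Nat.succ_eq_add_one, Nat.add_sub_cancel]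
    ring
  · have : Real.log r₂ ≤ Real.log r₁ := Real.log_le_log hr₂ hr
    have : 0 ≤ Real.log r₁ - Real.log r₂ := by linarith
    positivity
  · have := norm_mul_le_of_forall_radius hr₁ hr₁1 (Nat.succ_ne_zero k) (hsym k)
      (M := fun ρ => Real.log ρ - Real.log r₂ - (a 0).re)
      (β := fun ρ => ρ * Real.log ρ - ρ * Real.log r₂)
      (Continuous.continuousAt (by fun_prop)) (fun ρ _ _ => by ring) (fun ρ h1 h2 => by
        rw [← hcast]
        refine hup ρ _ h1 h2 (fun ζ hζ => ?_) _ (by omega)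
        have := h.log_lt_re hf hr₂ (hmem h1 h2 hζ)
        rw [← hζ, Real.log_exp, Complex.sub_re]
        linarith)
    rw [div_mul_eq_mul_div, le_div_iff₀ hden]
    refine this.trans (le_of_eq ?_)
    simp only [Nat.succ_eq_add_one, Nat.add_sub_cancel]
    ring

end IsLogLift

/-- The coefficient sizes are controlled by the displacement at one point and by the change of
the modulus, unless the latter is bounded away from zero. -/
theorem exists_coefficient_bound {K₂ κ : ℝ} (hK₂ : 0 < K₂) (hκ : 0 < κ) :
    ∃ K s : ℝ, 0 < K ∧ 0 < s ∧ ∀ r₁ r₂ c g : ℝ, 0 ≤ r₂ → r₂ ≤ r₁ → r₁ < 1 →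
      annulusOmega r₂ ≤ annulusOmega r₁ → κ ≤ 1 - r₁ ^ 2 → 0 ≤ c → 0 ≤ g →
      ∀ P : ℝ → Prop, P (2 * (r₁ * (2 * c - Real.log r₁)) / (1 - r₁ ^ 2)) →
      (0 < r₂ → P (2 * (r₁ * (Real.log r₁ - Real.log r₂)) / (1 - r₁ ^ 2))) →
      (∀ A, P A → 0 ≤ A ∧ c ≤ K₂ * (g + A)) →
      s ≤ annulusOmega r₁ - annulusOmega r₂ ∨
        ∃ A, P A ∧ c + A ≤ K * (g + (annulusOmega r₁ - annulusOmega r₂)) := by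
  have hπ := Real.pi_gt_three
  set K₃ := 4 * Real.pi / κ with hK₃
  have hK₃0 : 0 < K₃ := by positivity
  -- Chosen so that `K₂ * K₃ * t = 1 / 2`: for `r₁ ≤ t` the term in `c` coming from `A` is absorbed
  -- into the left-hand side.
  set t := 1 / (2 * K₂ * K₃) with ht
  have ht0 : 0 < t := by positivity
  set K := 2 * K₂ * (1 + K₃) + K₃ * (1 + 2 * K₂ * (1 + K₃)) with hK
  refine ⟨K, √t / 2, by positivity, by positivity, ?_⟩
  intro r₁ r₂ c g hr₂ hr hr₁ hω hκr hc hg P hP₁ hP₂ hP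
  set Δ := annulusOmega r₁ - annulusOmega r₂ with hΔ
  have hΔ0 : 0 ≤ Δ := by linarith
  have hden : 0 < 1 - r₁ ^ 2 := by linarith
  have hdiv : ∀ X Y : ℝ, 0 ≤ X → X ≤ Y → X / (1 - r₁ ^ 2) ≤ Y / κ := by
    intro X Y h1 h2
    exact div_le_div₀ (h1.trans h2) h2 hκ hκr
  have hfin : ∀ A, P A → A ≤ K₃ * Δ → c + A ≤ K * (g + Δ) := by
    intro A hA hAK
    obtain ⟨-, h2⟩ := hP A hA
    have h3 : c + A ≤ K₂ * (g + K₃ * Δ) + K₃ * Δ := by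
      have : K₂ * (g + A) ≤ K₂ * (g + K₃ * Δ) := by gcongr
      linarith
    refine h3.trans ?_
    have e : K * (g + Δ) - (K₂ * (g + K₃ * Δ) + K₃ * Δ) =
        (K - K₂) * g + (K - K₂ * K₃ - K₃) * Δ := by ring
    have e1 : 0 ≤ K - K₂ := by rw [hK]; ring_nf; positivity
    have e2 : 0 ≤ K - K₂ * K₃ - K₃ := by rw [hK]; ring_nf; positivity
    have : 0 ≤ (K - K₂) * g + (K - K₂ * K₃ - K₃) * Δ := by positivity
    linarith
  rcases (hr₂.trans hr).eq_or_lt with h0 | hr₁0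
  · right
    refine ⟨_, hP₁, hfin _ hP₁ ?_⟩
    rw [← h0]
    simp only [zero_mul, mul_zero, zero_div]
    positivity
  -- For comparable moduli the bound with `log r₂` is already of order `Δ`. Otherwise `ω₁ ≤ 2Δ`, and
  -- the bound without `r₂` suffices for small `r₁`, while a larger `r₁` forces `Δ ≥ √t / 2`.
  rcases le_or_gt (annulusOmega r₁) (2 * annulusOmega r₂) with hcase | hcase
  · right
    have hr₂0 : 0 < r₂ := by
      refine hr₂.lt_of_ne' fun h => ?_
      have := annulusOmega_pos hr₁0 hr₁
      have : annulusOmega r₂ = 0 := by simp [annulusOmega, h]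
      linarith
    refine ⟨_, hP₂ hr₂0, hfin _ (hP₂ hr₂0) ?_⟩
    have h1 := mul_log_sub_log_le hr₂0 (hr.trans_lt hr₁) hr₁0 hr₁ hω hcase
    have h2 : Real.log r₂ ≤ Real.log r₁ := Real.log_le_log hr₂0 hr
    refine (hdiv _ (4 * Real.pi * Δ) (by
      have : 0 ≤ Real.log r₁ - Real.log r₂ := by linarith
      positivity) (by linarith)).trans (le_of_eq ?_)
    rw [hK₃]; ring
  · have hω₁ : annulusOmega r₁ ≤ 2 * Δ := by linarith
    rcases le_or_gt r₁ t with hrt | hrt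
    · right
      refine ⟨_, hP₁, ?_⟩
      obtain ⟨hA0, hcA⟩ := hP _ hP₁
      have h1 := neg_mul_log_le hr₁0 hr₁
      set A := 2 * (r₁ * (2 * c - Real.log r₁)) / (1 - r₁ ^ 2)
      have hA : A ≤ K₃ * (r₁ * c + Δ) := by
        refine (hdiv _ (4 * Real.pi * (r₁ * c + Δ)) ?_ ?_).trans (le_of_eq ?_)
        · have := Real.log_neg hr₁0 hr₁
          have : 0 ≤ 2 * c - Real.log r₁ := by linarith
          positivity
        · have h2 : 0 ≤ r₁ * c := by positivity
          have h3 : Real.pi * annulusOmega r₁ ≤ Real.pi * (2 * Δ) := by gcongr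
          have h4 : 4 * (r₁ * c) ≤ 4 * Real.pi * (r₁ * c) := by gcongr; linarith
          linarith
        · rw [hK₃]; ring
      have hprod : K₂ * (K₃ * (r₁ * c)) ≤ c / 2 := by
        calc K₂ * (K₃ * (r₁ * c)) ≤ K₂ * (K₃ * (t * c)) := by gcongr
          _ = c / 2 := by rw [ht]; field_simp
      have hc2 : c ≤ 2 * K₂ * (g + K₃ * Δ) := by
        have : K₂ * (g + A) ≤ K₂ * (g + K₃ * (r₁ * c + Δ)) := by gcongr
        linarith
      have hA2 : A ≤ K₃ * (c + Δ) := hA.trans (by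
        gcongr
        nlinarith)
      have hc3 : c ≤ 2 * K₂ * (1 + K₃) * (g + Δ) := by
        refine hc2.trans ?_
        have : g + K₃ * Δ ≤ (1 + K₃) * (g + Δ) := by nlinarith [mul_nonneg hK₃0.le hg]
        calc _ ≤ 2 * K₂ * ((1 + K₃) * (g + Δ)) := by gcongr
          _ = _ := by ring
      have hA3 : A ≤ K₃ * (2 * K₂ * (1 + K₃) * (g + Δ) + (g + Δ)) := hA2.trans (by
        gcongr
        linarith)
      rw [hK]
      linarith
    · left
      have h1 := le_annulusOmega_sq hr₁0 hr₁
      have h2 : √t ≤ annulusOmega r₁ :=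
        Real.sqrt_le_iff.2 ⟨(annulusOmega_pos hr₁0 hr₁).le, by linarith⟩
      linarith

/-! ### Displacement on compact parts. -/

theorem log_mem_logStrip {r : ℝ} (hr : 0 ≤ r) {z : ℂ} (hz : z ∈ annulus r) :
    Complex.log z ∈ logStrip r := by
  have : z ≠ 0 := norm_pos_iff.1 (hr.trans_lt hz.1)
  rwa [← exp_mem_annulus_iff, Complex.exp_log this]

theorem norm_exp_sub_exp_le {ζ η : ℂ} (hζ : ‖Complex.exp ζ‖ ≤ 1) (hη : ‖Complex.exp η‖ ≤ 1) :
    ‖Complex.exp η - Complex.exp ζ‖ ≤ 2 * ‖ζ - η‖ := by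
  rcases le_or_gt ‖ζ - η‖ 1 with h | h
  · have e : Complex.exp η - Complex.exp ζ = Complex.exp ζ * (Complex.exp (η - ζ) - 1) := by
      rw [mul_sub, ← Complex.exp_add]; ring_nf
    rw [e, norm_mul, norm_sub_rev ζ]
    rw [norm_sub_rev] at h
    have := Complex.norm_exp_sub_one_le h
    calc _ ≤ 1 * (2 * ‖η - ζ‖) := by gcongr
      _ = _ := one_mul _
  · linarith [norm_sub_le (Complex.exp η) (Complex.exp ζ)]

/-- The compact part of an annulus on which the constants below are uniform. -/
def InnerPart (δ q r : ℝ) (z : ℂ) : Prop := δ ≤ ‖z‖ ∧ ‖z‖ ≤ q ∧ r ≤ q * ‖z‖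

theorem InnerPart.mem_annulus {δ q r : ℝ} (hδ : 0 < δ) (hq : q < 1) {z : ℂ}
    (h : InnerPart δ q r z) : z ∈ annulus r :=
  ⟨by nlinarith [h.1, h.2.2], h.2.1.trans_lt hq⟩

theorem InnerPart.le_sub {δ q r : ℝ} (hq : q < 1) {z : ℂ}
    (h : InnerPart δ q r z) : (1 - q) * δ ≤ ‖z‖ - r := by
  nlinarith [h.1, h.2.2]

/-- A map of annuli of degree one is close to the identity on compact sets as soon as it is close
to the identity at one point and the two annuli have almost the same modulus. -/
theorem exists_norm_sub_le_mul {δ q : ℝ} (hδ : 0 < δ) (hq : q < 1) :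
    ∃ C : ℝ, 0 ≤ C ∧ ∀ (r₁ r₂ : ℝ) (f F : ℂ → ℂ), 0 ≤ r₂ → r₂ ≤ r₁ → r₁ < 1 →
      annulusOmega r₂ ≤ annulusOmega r₁ → MapsTo f (annulus r₁) (annulus r₂) →
      IsLogLift r₁ f F 1 → ∀ w w₀, InnerPart δ q r₁ w → InnerPart δ q r₁ w₀ →
      ‖f w - w‖ ≤ C * (‖f w₀ - w₀‖ + (annulusOmega r₁ - annulusOmega r₂)) := by
  rcases lt_or_ge q δ with hqδ | hδq
  · refine ⟨0, le_rfl, fun r₁ r₂ f F _ _ _ _ _ _ w w₀ hw _ => absurd (hw.1.trans hw.2.1) ?_⟩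
    exact hqδ.not_ge
  have hq0 : 0 < q := hδ.trans_le hδq
  set d := (1 - q) * δ with hd
  have h1q : 0 < 1 - q := by linarith
  have hd0 : 0 < d := by positivity
  set K₁ := 2 / (1 - q) + 1 / d with hK₁
  set K₂ := 2 / (1 - q) * (1 + 1 / d) with hK₂
  obtain ⟨K, s, hK, hs, hmain⟩ := exists_coefficient_bound (K₂ := K₂) (κ := 1 - q)
    (by positivity) h1q
  have hK₁0 : 0 < K₁ := by positivity
  refine ⟨max (4 / δ) (max (2 / s) (2 * (1 + 2 * K₁ * K) * (2 / δ + 1))),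
    le_max_of_le_left (by positivity), ?_⟩
  set C := max (4 / δ) (max (2 / s) (2 * (1 + 2 * K₁ * K) * (2 / δ + 1)))
  have hC₁ : 4 / δ ≤ C := le_max_left _ _
  have hC₂ : 2 / s ≤ C := (le_max_left _ _).trans (le_max_right _ _)
  have hC₃ : 2 * (1 + 2 * K₁ * K) * (2 / δ + 1) ≤ C := (le_max_right _ _).trans (le_max_right _ _)
  intro r₁ r₂ f F₀ hr₂ hr hr₁1 hω hf hF₀ w w₀ hw hw₀
  have hr₁ : 0 ≤ r₁ := hr₂.trans hr
  have hwA := hw.mem_annulus hδ hq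
  have hw₀A := hw₀.mem_annulus hδ hq
  set ε := ‖f w₀ - w₀‖ with hε
  set Δ := annulusOmega r₁ - annulusOmega r₂ with hΔ
  have hε0 : 0 ≤ ε := norm_nonneg _
  have hΔ0 : 0 ≤ Δ := by linarith
  have hC0 : 0 ≤ C := le_trans (by positivity) hC₁
  have htriv : ‖f w - w‖ ≤ 2 := by
    have := (hf hwA).2
    linarith [norm_sub_le (f w) w, hwA.2]
  -- A displacement of at least `δ / 2` makes the claim trivial. Below that, `f w₀ / w₀` is within
  -- `1 / 2` of `1` and its principal logarithm is of order `ε`.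
  rcases le_or_gt (δ / 2) ε with hεδ | hεδ
  · calc ‖f w - w‖ ≤ 4 / δ * (δ / 2) := htriv.trans (le_of_eq (by field_simp; norm_num))
      _ ≤ C * (ε + Δ) := by gcongr; linarith
  have hw0 : w ≠ 0 := norm_pos_iff.1 (hr₁.trans_lt hwA.1)
  have hw₀0 : w₀ ≠ 0 := norm_pos_iff.1 (hr₁.trans_lt hw₀A.1)
  have hζ := log_mem_logStrip hr₁ hwA
  have hζ₀ := log_mem_logStrip hr₁ hw₀A
  have hquot : ‖(f w₀ - w₀) / w₀‖ ≤ ε / δ := by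
    rw [norm_div]
    gcongr
    exact hw₀.1
  have hl : ‖Complex.log (1 + (f w₀ - w₀) / w₀)‖ ≤ 2 / δ * ε := by
    refine (Complex.norm_log_one_add_half_le_self (hquot.trans ?_)).trans ?_
    · rw [div_le_iff₀ hδ]; linarith
    · calc 3 / 2 * ‖(f w₀ - w₀) / w₀‖ ≤ 2 * (ε / δ) := by gcongr; norm_num
        _ = _ := by ring
  -- The lift is only determined up to `2πi m`. This `m` selects the branch that is close to the
  -- identity at `log w₀`.
  obtain ⟨m, hm⟩ : ∃ m : ℤ, F₀ (Complex.log w₀) = Complex.log w₀ +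
      Complex.log (1 + (f w₀ - w₀) / w₀) + m * (2 * Real.pi * Complex.I) := by
    refine Complex.exp_eq_exp_iff_exists_int.1 ?_
    have hfw : f w₀ ≠ 0 := norm_pos_iff.1 (hr₂.trans_lt (hf hw₀A).1)
    have e : 1 + (f w₀ - w₀) / w₀ = f w₀ / w₀ := by field_simp; ring
    rw [hF₀.exp_eq _ hζ₀, Complex.exp_add, Complex.exp_log hw₀0, e,
      Complex.exp_log (div_ne_zero hfw hw₀0)]
    field_simp
  have hF := hF₀.sub_const m
  set F : ℂ → ℂ := fun ζ => F₀ ζ - m * (2 * Real.pi * Complex.I) with hFdef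
  have hg : ‖Complex.log w₀ - F (Complex.log w₀)‖ ≤ 2 / δ * ε := by
    have : Complex.log w₀ - F (Complex.log w₀) = -Complex.log (1 + (f w₀ - w₀) / w₀) := by
      simp only [hFdef, hm]; ring
    rwa [this, norm_neg]
  set g := ‖Complex.log w₀ - F (Complex.log w₀)‖ with hgdef
  obtain ⟨a, c, ha, hb₁, hb₂⟩ := hF.exists_laurentBounds hf hr₁ hr₁1 hr
  have hsum : ∀ z : ℂ, r₁ < ‖z‖ → ‖z‖ < 1 → (Summable fun n : ℤ => a n * z ^ n) →
      HasSum (fun n : ℤ => a n * z ^ n) (Complex.log z - F (Complex.log z)) := by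
    intro z h1 h2
    have := ha _ (log_mem_logStrip hr₁ ⟨h1, h2⟩)
    rwa [Complex.exp_log (norm_pos_iff.1 (hr₁.trans_lt h1))] at this
  have hre : ∀ z : ℂ, r₁ < ‖z‖ → ‖z‖ < 1 →
      Real.log ‖z‖ ≤ (Complex.log z - F (Complex.log z)).re := by
    intro z h1 h2
    have := hF.re_neg hf (log_mem_logStrip hr₁ ⟨h1, h2⟩)
    rw [Complex.sub_re, Complex.log_re]
    linarith
  have hκ : 1 - q ≤ 1 - r₁ ^ 2 := by
    have : r₁ ≤ q := hw.2.2.trans (mul_le_of_le_one_right hq0.le hwA.2.le)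
    nlinarith
  have hcK : ∀ A, LaurentBounds r₁ c A a → 0 ≤ A ∧ c ≤ K₂ * (g + A) := by
    intro A hA
    have hA0 := hA.nonneg
    refine ⟨hA0, ?_⟩
    have h1 := hA.c_le hr₁ hr₁1 (G := fun z => Complex.log z - F (Complex.log z)) hre hsum
      hw₀A.1 hw₀A.2
    have h2 : A / (‖w₀‖ - r₁) ≤ A / d := by
      gcongr
      exact hw₀.le_sub hq
    have h3 : (Complex.log w₀ - F (Complex.log w₀)).re ≤ g := Complex.re_le_norm _
    have h4 : (1 - q) * c ≤ 2 * (g + A / d) := by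
      have : (1 - q) * c ≤ (1 - ‖w₀‖) * c := by
        have := hA.c_nonneg
        gcongr
        exact hw₀.2.1
      linarith
    have h5 : g + A / d ≤ (1 + 1 / d) * (g + A) := by
      have : 0 ≤ 1 / d * g := by positivity
      have : A / d = 1 / d * A := by ring
      nlinarith
    calc c = (1 - q) * c / (1 - q) := by field_simp
      _ ≤ 2 * ((1 + 1 / d) * (g + A)) / (1 - q) :=
        div_le_div_of_nonneg_right (by linarith) h1q.le
      _ = K₂ * (g + A) := by rw [hK₂]; ring
  rcases hmain r₁ r₂ c g hr₂ hr hr₁1 hω hκ hb₁.c_nonneg (norm_nonneg _)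
    (fun A => LaurentBounds r₁ c A a) hb₁ hb₂ hcK with hsΔ | ⟨A, hA, hcA⟩
  · calc ‖f w - w‖ ≤ 2 / s * s := htriv.trans (le_of_eq (by field_simp))
      _ ≤ C * (ε + Δ) := by gcongr; linarith
  · have hA0 := hA.nonneg
    have hc0 := hA.c_nonneg
    -- Both `w` and `w₀` deviate little from the common value `a 0`, so the displacement at `w₀`
    -- transfers to `w`.
    have hdev : ∀ z, InnerPart δ q r₁ z →
        ‖Complex.log z - F (Complex.log z) - a 0‖ ≤ K₁ * (c + A) := by
      intro z hz
      have hzA := hz.mem_annulus hδ hq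
      refine (hA.norm_sub_le hr₁ hzA.1 hzA.2 (hsum z hzA.1 hzA.2)).trans ?_
      have h1 : A / (‖z‖ - r₁) ≤ A / d := by
        gcongr
        exact hz.le_sub hq
      have h2 : (2 * c + A) * ‖z‖ / (1 - ‖z‖) ≤ (2 * c + 2 * A) * 1 / (1 - q) := by
        gcongr
        · linarith
        · exact hzA.2.le
        · exact hz.2.1
      have h3 : K₁ * (c + A) = (2 * c + 2 * A) * 1 / (1 - q) + (c / d + A / d) := by
        rw [hK₁]; ring
      have h4 : 0 ≤ c / d := by positivity
      linarith
    have hG : ‖Complex.log w - F (Complex.log w)‖ ≤ (1 + 2 * K₁ * K) * (g + Δ) := by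
      have h1 := hdev w hw
      have h2 := hdev w₀ hw₀
      have h3 : Complex.log w - F (Complex.log w) = (Complex.log w - F (Complex.log w) - a 0) -
          (Complex.log w₀ - F (Complex.log w₀) - a 0) +
          (Complex.log w₀ - F (Complex.log w₀)) := by ring
      have h4 : ‖Complex.log w - F (Complex.log w)‖ ≤ K₁ * (c + A) + K₁ * (c + A) + g := by
        rw [h3]
        refine (norm_add_le _ _).trans (add_le_add ((norm_sub_le _ _).trans (add_le_add h1 h2)) le_rfl)
      have h5 : K₁ * (c + A) ≤ K₁ * (K * (g + Δ)) := by gcongr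
      linarith
    have hexp : f w - w = Complex.exp (F (Complex.log w)) - Complex.exp (Complex.log w) := by
      rw [hF.exp_eq _ hζ, Complex.exp_log hw0]
    have hfin : ‖f w - w‖ ≤ 2 * ‖Complex.log w - F (Complex.log w)‖ := by
      rw [hexp]
      refine norm_exp_sub_exp_le ?_ ?_
      · rw [Complex.exp_log hw0]; exact hwA.2.le
      · rw [hF.exp_eq _ hζ, Complex.exp_log hw0]; exact (hf hwA).2.le
    have hgε : g + Δ ≤ (2 / δ + 1) * (ε + Δ) := by
      have : 0 ≤ 2 / δ * Δ := by positivity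
      linarith
    calc ‖f w - w‖ ≤ 2 * ((1 + 2 * K₁ * K) * (g + Δ)) := hfin.trans (by gcongr)
      _ ≤ 2 * ((1 + 2 * K₁ * K) * ((2 / δ + 1) * (ε + Δ))) := by gcongr
      _ = 2 * (1 + 2 * K₁ * K) * (2 / δ + 1) * (ε + Δ) := by ring
      _ ≤ C * (ε + Δ) := by gcongr

/-! ### Uniform Harnack estimates and images of compact parts. -/

/-- Harnack's inequality along a segment. -/
theorem re_le_pow_mul_re_of_segment {h : ℂ → ℂ} {U : Set ℂ} (hd : DifferentiableOn ℂ h U)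
    (hpos : ∀ z ∈ U, 0 < (h z).re) {x y : ℂ} {η : ℝ} (hη : 0 < η)
    (hball : ∀ p ∈ segment ℝ x y, Metric.ball p η ⊆ U) {N : ℕ} (hN : ‖y - x‖ ≤ N * (η / 2)) :
    (h y).re ≤ 3 ^ N * (h x).re := by
  rcases Nat.eq_zero_or_pos N with rfl | hN0
  · have : y = x := by
      rw [← sub_eq_zero, ← norm_le_zero_iff]
      simpa using hN
    simp [this]
  have hNr : (0 : ℝ) < N := by exact_mod_cast hN0
  let p : ℕ → ℂ := fun i => AffineMap.lineMap x y ((i : ℝ) / N)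
  have hp : ∀ i ≤ N, p i ∈ segment ℝ x y := by
    intro i hi
    rw [segment_eq_image_lineMap]
    refine ⟨_, ⟨by positivity, ?_⟩, rfl⟩
    rw [div_le_one hNr]
    exact_mod_cast hi
  have hstep : ∀ i, dist (p (i + 1)) (p i) ≤ η / 2 := by
    intro i
    rw [dist_lineMap_lineMap, Real.dist_eq, dist_comm, dist_eq_norm]
    have : ((i + 1 : ℕ) : ℝ) / N - i / N = 1 / N := by push_cast; ring
    rw [this, abs_of_pos (by positivity), one_div_mul_eq_div, div_le_iff₀ hNr]
    linarith
  have key : ∀ i ≤ N, (h (p i)).re ≤ 3 ^ i * (h x).re := by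
    intro i
    induction i with
    | zero => intro _; simp [p]
    | succ i ih =>
      intro hi
      have hi' : i ≤ N := by omega
      have hb := hball _ (hp i hi')
      have hdist := hstep i
      have hd0 : 0 ≤ dist (p (i + 1)) (p i) := dist_nonneg
      have hin : p (i + 1) ∈ Metric.ball (p i) η := by
        rw [Metric.mem_ball]; linarith
      have h1 := (re_le_mul_re_of_forall_re_pos (hd.mono hb) (fun z hz => hpos z (hb hz)) hin).1
      have p1 := hpos _ (hb hin)
      have p2 := hpos _ (hb (Metric.mem_ball_self hη))
      -- Steps of length at most `η / 2` in balls of radius `η` cost the factor `(1 + 1/2) / (1 -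
      -- 1/2) = 3`.
      have h2 : (h (p (i + 1))).re ≤ 3 * (h (p i)).re := by
        by_contra! hcon
        nlinarith
      rw [pow_succ]
      linarith [ih hi']
  have := key N le_rfl
  simpa [p, div_self hNr.ne'] using this

theorem ball_subset_logStrip {q r : ℝ} (hq0 : 0 < q) {p : ℂ} (h1 : Real.exp p.re ≤ q)
    (h2 : r ≤ q * Real.exp p.re) : Metric.ball p (-Real.log q) ⊆ logStrip r := by
  intro z hz
  have hz' : |z.re - p.re| < -Real.log q := by
    have := Complex.abs_re_le_norm (z - p)
    rw [Metric.mem_ball, dist_eq_norm] at hz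
    rw [Complex.sub_re] at this
    linarith
  rw [abs_lt] at hz'
  constructor
  · calc r ≤ q * Real.exp p.re := h2
      _ = Real.exp (Real.log q + p.re) := by rw [Real.exp_add, Real.exp_log hq0]
      _ < Real.exp z.re := Real.exp_lt_exp.2 (by linarith)
  · calc Real.exp z.re < Real.exp (-Real.log q + p.re) := Real.exp_lt_exp.2 (by linarith)
      _ = q⁻¹ * Real.exp p.re := by rw [Real.exp_add, Real.exp_neg, Real.exp_log hq0]
      _ ≤ q⁻¹ * q := by gcongr
      _ = 1 := inv_mul_cancel₀ hq0.ne'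

/-- Logarithms of points of the inner part lie in a rectangle of width `-log δ` and height `2π`, at
distance at least `-log q` from both edges of the strip. The number of balls needed is thus
independent of `r`. -/
theorem exists_harnack_constant {δ q : ℝ} (hδ : 0 < δ) (hq0 : 0 < q) (hq : q < 1) :
    ∃ Λ : ℝ, 1 ≤ Λ ∧ ∀ (r : ℝ) (h : ℂ → ℂ), DifferentiableOn ℂ h (logStrip r) →
      (∀ ζ ∈ logStrip r, 0 < (h ζ).re) → ∀ z w, InnerPart δ q r z → InnerPart δ q r w →
      (h (Complex.log z)).re ≤ Λ * (h (Complex.log w)).re := by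
  have hη : 0 < -Real.log q := by linarith [Real.log_neg hq0 hq]
  obtain ⟨N, hN⟩ := exists_nat_ge ((-Real.log δ + 2 * Real.pi) / (-Real.log q / 2))
  rw [div_le_iff₀ (by positivity)] at hN
  refine ⟨3 ^ N, one_le_pow₀ (by norm_num), fun r h hd hpos z w hz hw => ?_⟩
  have hre : ∀ v, InnerPart δ q r v → Real.exp (Complex.log v).re = ‖v‖ := by
    intro v hv
    rw [Complex.log_re, Real.exp_log (hδ.trans_le hv.1)]
  have hlog : ∀ v, InnerPart δ q r v → Real.log δ ≤ (Complex.log v).re ∧ (Complex.log v).re ≤ 0 := by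
    intro v hv
    rw [Complex.log_re]
    exact ⟨Real.log_le_log hδ hv.1, Real.log_nonpos (norm_nonneg _) (hv.2.1.trans hq.le)⟩
  refine re_le_pow_mul_re_of_segment hd hpos hη (fun p hp => ?_) (le_trans ?_ hN)
  · have hseg : p.re ∈ segment ℝ (Complex.log w).re (Complex.log z).re := by
      obtain ⟨a, b, ha, hb, hab, rfl⟩ := hp
      exact ⟨a, b, ha, hb, hab, by simp⟩
    rw [segment_eq_uIcc, mem_uIcc] at hseg
    refine ball_subset_logStrip hq0 ?_ ?_
    · rcases hseg with h | h
      · exact (Real.exp_le_exp.2 h.2).trans ((hre z hz).le.trans hz.2.1)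
      · exact (Real.exp_le_exp.2 h.2).trans ((hre w hw).le.trans hw.2.1)
    · rcases hseg with h | h
      · refine hw.2.2.trans ?_
        rw [← hre w hw]
        exact mul_le_mul_of_nonneg_left (Real.exp_le_exp.2 h.1) hq0.le
      · refine hz.2.2.trans ?_
        rw [← hre z hz]
        exact mul_le_mul_of_nonneg_left (Real.exp_le_exp.2 h.1) hq0.le
  · refine (Complex.norm_le_abs_re_add_abs_im _).trans (add_le_add ?_ ?_)
    · rw [Complex.sub_re, abs_le]
      constructor <;> linarith [(hlog z hz).1, (hlog z hz).2, (hlog w hw).1, (hlog w hw).2]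
    · rw [Complex.sub_im, Complex.log_im, Complex.log_im, abs_le]
      constructor <;> linarith [Complex.neg_pi_lt_arg z, Complex.arg_le_pi z,
        Complex.neg_pi_lt_arg w, Complex.arg_le_pi w]

/-- Maps of annuli that keep one point in a compact part keep every compact part in a compact part,
uniformly. -/
theorem exists_innerPart_image {δ q : ℝ} (hδ : 0 < δ) (hq0 : 0 < q) (hq : q < 1) :
    ∃ δ' q' : ℝ, 0 < δ' ∧ δ' ≤ δ ∧ q ≤ q' ∧ q' < 1 ∧
      ∀ (r₁ r₂ : ℝ) (f F : ℂ → ℂ) (n : ℤ), 0 ≤ r₁ → 0 ≤ r₂ → MapsTo f (annulus r₁) (annulus r₂) →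
      IsLogLift r₁ f F n → ∀ z w, InnerPart δ q r₁ z → InnerPart δ q r₁ w →
      InnerPart δ q r₂ (f w) → InnerPart δ' q' r₂ (f z) := by
  obtain ⟨Λ, hΛ, hmain⟩ := exists_harnack_constant hδ hq0 hq
  have hΛ0 : 0 < Λ := by linarith
  have hlq : Real.log q < 0 := Real.log_neg hq0 hq
  -- Multiplying logarithms by `Λ` or `Λ⁻¹` turns `δ` into `δ ^ Λ` and `q` into `q ^ (1 / Λ)`.
  refine ⟨min δ (Real.exp (Λ * Real.log δ)), Real.exp (Λ⁻¹ * Real.log q), by positivity,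
    min_le_left _ _, ?_, ?_, ?_⟩
  · rw [← Real.log_le_iff_le_exp hq0]
    have : Λ⁻¹ ≤ 1 := inv_le_one_of_one_le₀ hΛ
    nlinarith
  · rw [Real.exp_lt_one_iff]
    have : 0 < Λ⁻¹ := by positivity
    nlinarith
  intro r₁ r₂ f F n hr₁ hr₂ hf hF z w hz hw hfw
  have hzA := hz.mem_annulus hδ hq
  have hwA := hw.mem_annulus hδ hq
  have hFre : ∀ v ∈ annulus r₁, (F (Complex.log v)).re = Real.log ‖f v‖ := by
    intro v hv
    rw [← Real.log_exp (F (Complex.log v)).re, hF.exp_re (log_mem_logStrip hr₁ hv),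
      Complex.exp_log (norm_pos_iff.1 (hr₁.trans_lt hv.1))]
  have hfz0 : 0 < ‖f z‖ := hr₂.trans_lt (hf hzA).1
  have hfw0 : 0 < ‖f w‖ := hδ.trans_le hfw.1
  have hneg : ∀ z w, InnerPart δ q r₁ z → InnerPart δ q r₁ w →
      -Real.log ‖f z‖ ≤ Λ * -Real.log ‖f w‖ := by
    intro z w hz hw
    have := hmain r₁ (fun ζ => -F ζ) hF.differentiableOn.fun_neg (fun ζ hζ => by
      have := hF.re_neg hf hζ
      rw [Complex.neg_re]; linarith) z w hz hw
    rwa [Complex.neg_re, Complex.neg_re, hFre z (hz.mem_annulus hδ hq),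
      hFre w (hw.mem_annulus hδ hq)] at this
  have hlw : Real.log ‖f w‖ ≤ Real.log q := Real.log_le_log hfw0 hfw.2.1
  have hlw' : Real.log δ ≤ Real.log ‖f w‖ := Real.log_le_log hδ hfw.1
  refine ⟨?_, ?_, ?_⟩
  · refine (min_le_right _ _).trans ?_
    rw [← Real.le_log_iff_exp_le hfz0]
    have := hneg z w hz hw
    nlinarith
  · rw [← Real.log_le_iff_le_exp hfz0, inv_mul_eq_div, le_div_iff₀ hΛ0]
    have := hneg w z hw hz
    nlinarith
  · rcases hr₂.eq_or_lt with h0 | hr₂0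
    · rw [← h0]; positivity
    -- The inner boundary is handled by applying the same Harnack constant to the positive function
    -- `Re F - log r₂`.
    have hsh := hmain r₁ (fun ζ => F ζ - Real.log r₂) (hF.differentiableOn.sub_const _)
      (fun ζ hζ => by
        have := hF.log_lt_re hf hr₂0 hζ
        rw [Complex.sub_re, Complex.ofReal_re]; linarith) w z hw hz
    rw [Complex.sub_re, Complex.sub_re, Complex.ofReal_re, hFre z hzA, hFre w hwA] at hsh
    have hlr : Real.log r₂ ≤ Real.log q + Real.log ‖f w‖ := by
      rw [← Real.log_mul hq0.ne' hfw0.ne']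
      exact Real.log_le_log hr₂0 hfw.2.2
    have : Real.log r₂ ≤ Λ⁻¹ * Real.log q + Real.log ‖f z‖ := by
      have : Λ⁻¹ * -Real.log q ≤ Λ⁻¹ * (Λ * (Real.log ‖f z‖ - Real.log r₂)) := by
        gcongr
        linarith
      rw [inv_mul_cancel_left₀ hΛ0.ne'] at this
      linarith
    calc r₂ = Real.exp (Real.log r₂) := (Real.exp_log hr₂0).symm
      _ ≤ Real.exp (Λ⁻¹ * Real.log q + Real.log ‖f z‖) := Real.exp_le_exp.2 this
      _ = _ := by rw [Real.exp_add, Real.exp_log hfz0]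

/-! ### Increments of absolutely continuous functions. -/

theorem AbsolutelyContinuousOnInterval.of_dist_le {X Y : Type*} [PseudoMetricSpace X]
    [PseudoMetricSpace Y] {f : ℝ → X} {g : ℝ → Y} {a b : ℝ}
    (hf : AbsolutelyContinuousOnInterval f a b) (h : ∀ x y, dist (g x) (g y) ≤ dist (f x) (f y)) :
    AbsolutelyContinuousOnInterval g a b :=
  squeeze_zero (fun _ => Finset.sum_nonneg fun _ _ => dist_nonneg)
    (fun _ => Finset.sum_le_sum fun _ _ => h _ _) hf

theorem AbsolutelyContinuousOnInterval.abs_sub_le_integral {f : ℝ → ℝ} {a b : ℝ} (hab : a ≤ b)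
    (hf : AbsolutelyContinuousOnInterval f a b) : |f b - f a| ≤ ∫ x in a..b, ‖deriv f x‖ := by
  rw [← hf.integral_deriv_eq_sub, ← Real.norm_eq_abs]
  exact intervalIntegral.norm_integral_le_integral_norm hab

/-- Reduction to the real and imaginary parts; this is the source of the factor `2`. -/
theorem AbsolutelyContinuousOnInterval.norm_sub_le_integral {f : ℝ → ℂ} {a b : ℝ} (hab : a ≤ b)
    (hf : AbsolutelyContinuousOnInterval f a b)
    (hi : IntervalIntegrable (fun x => ‖deriv f x‖) volume a b) :
    ‖f b - f a‖ ≤ ∫ x in a..b, 2 * ‖deriv f x‖ := by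
  have hre : AbsolutelyContinuousOnInterval (fun x => (f x).re) a b := hf.of_dist_le fun x y => by
    rw [Real.dist_eq, dist_eq_norm, ← Complex.sub_re]
    exact Complex.abs_re_le_norm _
  have him : AbsolutelyContinuousOnInterval (fun x => (f x).im) a b := hf.of_dist_le fun x y => by
    rw [Real.dist_eq, dist_eq_norm, ← Complex.sub_im]
    exact Complex.abs_im_le_norm _
  -- Almost everywhere both parts are differentiable, hence so is `f`, and `deriv f` is not the
  -- default value `0` of a nondifferentiable point.
  have hderiv : ∀ᵐ x, x ∈ uIcc a b → ‖deriv (fun x => (f x).re) x‖ ≤ ‖deriv f x‖ ∧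
      ‖deriv (fun x => (f x).im) x‖ ≤ ‖deriv f x‖ := by
    filter_upwards [hre.ae_differentiableAt, him.ae_differentiableAt] with x h1 h2 hx
    have hd : HasDerivAt f (((deriv (fun x => (f x).re) x : ℝ) : ℂ) +
        ((deriv (fun x => (f x).im) x : ℝ) : ℂ) * Complex.I) x := by
      have := (h1 hx).hasDerivAt.ofReal_comp.add ((h2 hx).hasDerivAt.ofReal_comp.mul_const Complex.I)
      exact this.congr_of_eventuallyEq (Eventually.of_forall fun y => (Complex.re_add_im (f y)).symm)
    rw [hd.deriv]
    set u := deriv (fun x => (f x).re) x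
    set v := deriv (fun x => (f x).im) x
    have h3 := Complex.abs_re_le_norm ((u : ℂ) + v * Complex.I)
    have h4 := Complex.abs_im_le_norm ((u : ℂ) + v * Complex.I)
    simp only [Complex.add_re, Complex.mul_re, Complex.ofReal_re, Complex.ofReal_im, Complex.I_re,
      Complex.I_im, Complex.add_im, Complex.mul_im, mul_zero, mul_one, sub_self, add_zero,
      zero_add] at h3 h4
    exact ⟨h3, h4⟩
  have hmono : ∀ g : ℝ → ℝ, AbsolutelyContinuousOnInterval g a b →
      (∀ᵐ x, x ∈ uIcc a b → ‖deriv g x‖ ≤ ‖deriv f x‖) →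
      |g b - g a| ≤ ∫ x in a..b, ‖deriv f x‖ := by
    intro g hg h
    refine (hg.abs_sub_le_integral hab).trans ?_
    refine intervalIntegral.integral_mono_ae_restrict hab hg.intervalIntegrable_deriv.norm hi ?_
    rw [EventuallyLE, ae_restrict_iff' measurableSet_Icc]
    filter_upwards [h] with x hx hx'
    exact hx (by rwa [uIcc_of_le hab])
  have h1 := hmono _ hre (hderiv.mono fun x hx h => (hx h).1)
  have h2 := hmono _ him (hderiv.mono fun x hx h => (hx h).2)
  rw [← Complex.sub_re] at h1
  rw [← Complex.sub_im] at h2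
  rw [intervalIntegral.integral_const_mul]
  linarith [Complex.norm_le_abs_re_add_abs_im (f b - f a)]

/-! ### Canonical systems and the main theorem. -/

/-- Up to the factor `π`, the inverse of `ω` is `exp (-1 / x)` extended by `0`. Its monotonicity and
continuity pass from `ω` to `r`, also at `r = 0`. -/
theorem expNegInvGlue_annulusOmega {r : ℝ} (h : 0 ≤ r) (h1 : r < 1) :
    expNegInvGlue (annulusOmega r / Real.pi) = r := by
  rcases h.eq_or_lt with rfl | h
  · simp [annulusOmega, expNegInvGlue]
  · have hp := annulusOmega_pos h h1
    rw [expNegInvGlue, if_neg (by have := Real.pi_pos; exact not_le.2 (by positivity)), inv_div,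
      ← neg_div, ← log_eq_neg_pi_div_annulusOmega h h1, Real.exp_log h]

theorem le_of_annulusOmega_le {r₁ r₂ : ℝ} (h₁ : 0 ≤ r₁) (h₁1 : r₁ < 1) (h₂ : 0 ≤ r₂)
    (h₂1 : r₂ < 1) (h : annulusOmega r₂ ≤ annulusOmega r₁) : r₂ ≤ r₁ := by
  rw [← expNegInvGlue_annulusOmega h₁ h₁1, ← expNegInvGlue_annulusOmega h₂ h₂1]
  exact expNegInvGlue.monotone (by have := Real.pi_pos; gcongr)

theorem IsCanonicalSystem.continuousOn {d : ℝ≥0∞} {r : ℝ → ℝ} (hr : IsCanonicalSystem d r) {T : ℝ}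
    (hT : 0 ≤ T) : ContinuousOn r (Icc 0 T) := by
  have h1 := (hr.omega_ACd.absolutelyContinuous 0 T hT Icc_subset_Ici_self).continuousOn
  rw [uIcc_of_le hT] at h1
  have h2 : ContinuousOn (fun t => expNegInvGlue (annulusOmega (r t) / Real.pi)) (Icc 0 T) :=
    (expNegInvGlue.contDiff (n := 0)).continuous.comp_continuousOn (h1.div_const _)
  refine h2.congr fun t ht => ?_
  exact (expNegInvGlue_annulusOmega (hr.mem_Ico t ht.1).1 (hr.mem_Ico t ht.1).2).symm

theorem IsCanonicalSystem.antitone {d : ℝ≥0∞} {r : ℝ → ℝ} (hr : IsCanonicalSystem d r) {s t : ℝ}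
    (hs : 0 ≤ s) (hst : s ≤ t) : r t ≤ r s :=
  have ht := hs.trans hst
  le_of_annulusOmega_le (hr.mem_Ico s hs).1 (hr.mem_Ico s hs).2 (hr.mem_Ico t ht).1
    (hr.mem_Ico t ht).2 (hr.omega_antitone hs ht hst)

theorem InnerPart.mono {δ q δ' q' r : ℝ} {z : ℂ} (h : InnerPart δ q r z) (hδ : δ' ≤ δ)
    (hq : q ≤ q') : InnerPart δ' q' r z :=
  ⟨hδ.trans h.1, h.2.1.trans hq, h.2.2.trans (by gcongr)⟩

theorem exists_innerPart_of_continuousOn {r : ℝ → ℝ} {w : ℝ → ℂ} {a b : ℝ} (hab : a ≤ b)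
    (hr : ContinuousOn r (Icc a b)) (hr0 : ∀ t ∈ Icc a b, 0 ≤ r t)
    (hw : ContinuousOn w (Icc a b)) (hm : ∀ t ∈ Icc a b, w t ∈ annulus (r t)) :
    ∃ δ q : ℝ, 0 < δ ∧ 0 < q ∧ q < 1 ∧ ∀ t ∈ Icc a b, InnerPart δ q (r t) (w t) := by
  have hpos : ∀ t ∈ Icc a b, 0 < ‖w t‖ := fun t ht => (hr0 t ht).trans_lt (hm t ht).1
  have hne : (Icc a b).Nonempty := nonempty_Icc.2 hab
  obtain ⟨t₀, ht₀, hmin⟩ := isCompact_Icc.exists_isMinOn hne hw.norm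
  obtain ⟨t₁, ht₁, hmax⟩ := isCompact_Icc.exists_isMaxOn hne hw.norm
  obtain ⟨t₂, ht₂, hmaxr⟩ := isCompact_Icc.exists_isMaxOn hne
    (hr.div hw.norm fun t ht => (hpos t ht).ne')
  refine ⟨‖w t₀‖, max ‖w t₁‖ (r t₂ / ‖w t₂‖), hpos _ ht₀, lt_max_of_lt_left (hpos _ ht₁),
    max_lt (hm _ ht₁).2 ((div_lt_one (hpos _ ht₂)).2 (hm _ ht₂).1), fun t ht => ⟨hmin ht, ?_, ?_⟩⟩
  · exact (hmax ht).trans (le_max_left _ _)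
  · rw [← div_le_iff₀ (hpos t ht)]
    exact (hmaxr ht).trans (le_max_right _ _)

theorem IsAlgebraicEvolutionFamily.exists_isLogLift {d : ℝ≥0∞} {r : ℝ → ℝ}
    (hr : IsCanonicalSystem d r) {φ : ℝ → ℝ → ℂ → ℂ} (hφ : IsAlgebraicEvolutionFamily r φ)
    (habc :
      (∀ t, 0 < t → ∀ s₀ ∈ Ico 0 t, ∀ z ∈ annulus (r s₀),
        ContinuousOn (fun s => φ s t z) (Icc s₀ t)) ∨
      (∀ s, 0 ≤ s → ∀ z ∈ annulus (r s), ContinuousOn (fun t => φ s t z) (Ici s)) ∨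
      (∀ s t, 0 ≤ s → s ≤ t → ClassM (r s) (r t) (φ s t)))
    {s t : ℝ} (hs : 0 ≤ s) (hst : s ≤ t) : ∃ F, IsLogLift (r s) (φ s t) F 1 := by
  have hrs := hr.mem_Ico s hs
  have hne : ∀ u v, 0 ≤ u → u ≤ v → ∀ z ∈ annulus (r u), φ u v z ≠ 0 := fun u v hu huv z hz =>
    norm_pos_iff.1 ((hr.mem_Ico v (hu.trans huv)).1.trans_lt (hφ.mapsTo u v hu huv hz).1)
  rcases habc with ha | hb | hc
  · rcases hst.eq_or_lt with rfl | hlt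
    · exact ⟨id, isLogLift_id (hφ.EF1 s hs)⟩
    have ht : 0 < t := hs.trans_lt hlt
    -- Under (a) the domain of `φ u t` varies with `u`. All the maps are restricted to the smallest
    -- annulus, that at time `s`.
    have hsub : ∀ u ∈ Icc s t, annulus (r s) ⊆ annulus (r u) := fun u hu z hz =>
      ⟨(hr.antitone hs hu.1).trans_lt hz.1, hz.2⟩
    exact exists_isLogLift_one_of_continuousOn hrs.1 hrs.2 isPreconnected_Icc
      (f := fun u => φ u t)
      (fun u hu => (hφ.holomorphic u t (hs.trans hu.1) hu.2).mono (hsub u hu))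
      (fun u hu z hz => (hφ.mapsTo u t (hs.trans hu.1) hu.2 (hsub u hu hz)).2)
      (fun u hu z hz => hne u t (hs.trans hu.1) hu.2 z (hsub u hu hz))
      (fun z hz => ha t ht s ⟨hs, hlt⟩ z hz) (right_mem_Icc.2 hst)
      (fun z hz => hφ.EF1 t ht.le z (hsub t (right_mem_Icc.2 hst) hz)) (left_mem_Icc.2 hst)
  · exact exists_isLogLift_one_of_continuousOn hrs.1 hrs.2 isPreconnected_Ici
      (f := fun u => φ s u)
      (fun u hu => hφ.holomorphic s u hs hu) (fun u hu z hz => (hφ.mapsTo s u hs hu hz).2)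
      (fun u hu z hz => hne s u hs hu z hz) (fun z hz => hb s hs z hz) self_mem_Ici
      (fun z hz => hφ.EF1 s hs z hz) hst
  · exact (hc s t hs hst).exists_isLogLift hrs.1 hrs.2 (hr.mem_Ico t (hs.trans hst)).1

theorem theorem4p4 (d : ℝ≥0∞) (hd : 1 ≤ d) (r : ℝ → ℝ) (hr : IsCanonicalSystem d r)
    (φ : ℝ → ℝ → ℂ → ℂ) (hφ : IsAlgebraicEvolutionFamily r φ)
    (habc :
      (∀ t, 0 < t → ∀ s₀ ∈ Ico 0 t, ∀ z ∈ annulus (r s₀),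
        ContinuousOn (fun s => φ s t z) (Icc s₀ t)) ∨
      (∀ s, 0 ≤ s → ∀ z ∈ annulus (r s), ContinuousOn (fun t => φ s t z) (Ici s)) ∨
      (∀ s t, 0 ≤ s → s ≤ t → ClassM (r s) (r t) (φ s t)))
    (z₀ : ℂ) (hz₀ : z₀ ∈ annulus (r 0))
    (htraj : IsACd d (Ici 0) puncturedDisk (fun t => φ 0 t z₀)) :
    IsEvolutionFamily d r φ := by
  refine { hφ with EF3 := fun S T hS hST z hz => ?_ }
  have hT : 0 ≤ T := hS.trans hST
  have hsubT : ∀ a b, 0 ≤ a → Icc a b ⊆ Ici (0 : ℝ) := fun a b ha x hx => ha.trans hx.1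
  set w : ℝ → ℂ := fun t => φ 0 t z₀ with hw
  have hwm : ∀ t, 0 ≤ t → w t ∈ annulus (r t) := fun t ht => hφ.mapsTo 0 t le_rfl ht hz₀
  have hwc : ContinuousOn w (Icc 0 T) := by
    have := (htraj.absolutelyContinuous 0 T hT (hsubT 0 T le_rfl)).continuousOn
    rwa [uIcc_of_le hT] at this
  obtain ⟨δ₁, q₁, hδ₁, hq₁0, hq₁, hw₁⟩ := exists_innerPart_of_continuousOn hT (hr.continuousOn hT)
    (fun t ht => (hr.mem_Ico t ht.1).1) hwc (fun t ht => hwm t ht.1)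
  have hSm : S ∈ Icc S T := left_mem_Icc.2 hST
  obtain ⟨δ₂, q₂, hδ₂, hq₂0, hq₂, hz₂⟩ := exists_innerPart_of_continuousOn (r := fun _ => r S)
    (w := fun _ => z) hST continuousOn_const (fun _ _ => (hr.mem_Ico S hS).1) continuousOn_const
    (fun _ _ => hz)
  have hδ : 0 < min δ₁ δ₂ := lt_min hδ₁ hδ₂
  have hq0 : 0 < max q₁ q₂ := lt_max_of_lt_left hq₁0
  have hq : max q₁ q₂ < 1 := max_lt hq₁ hq₂
  set δ := min δ₁ δ₂
  set q := max q₁ q₂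
  have hwI : ∀ t ∈ Icc 0 T, InnerPart δ q (r t) (w t) := fun t ht =>
    (hw₁ t ht).mono (min_le_left _ _) (le_max_left _ _)
  -- Since `r` is non-increasing, a point of the annulus at time `S` keeps its distance from the
  -- inner boundary afterwards.
  have hzI : ∀ s, S ≤ s → InnerPart δ q (r s) z := fun s hs => by
    have := (hz₂ S hSm).mono (min_le_right δ₁ δ₂) (le_max_right q₁ q₂)
    exact ⟨this.1, this.2.1, (hr.antitone hS hs).trans this.2.2⟩
  obtain ⟨δ', q', hδ', hδδ', hqq', hq', himage⟩ := exists_innerPart_image hδ hq0 hq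
  obtain ⟨C, hC0, hC⟩ := exists_norm_sub_le_mul hδ' hq'
  set o : ℝ → ℝ := fun t => annulusOmega (r t) with ho
  -- This `k` does not depend on `s`: the constants come from compact parts fixed by `z`, `S`, `T`
  -- and the trajectory of `z₀`.
  have hk : MemLp (fun ξ => C * (2 * ‖deriv w ξ‖ + ‖deriv o ξ‖)) d (volume.restrict (Icc S T)) :=
    (((htraj.deriv_memLp S T hST (hsubT S T hS)).norm.const_mul 2).add
      (hr.omega_ACd.deriv_memLp S T hST (hsubT S T hS)).norm).const_mul C
  refine ⟨_, fun ξ _ => by positivity, hk, fun s u t hSs hsu hut htT => ?_⟩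
  have hs0 : 0 ≤ s := hS.trans hSs
  have hu0 : 0 ≤ u := hs0.trans hsu
  have ht0 : 0 ≤ t := hu0.trans hut
  have hsz : z ∈ annulus (r s) := (hzI s hSs).mem_annulus hδ hq
  have hwsu : φ s u (w s) = w u := (hφ.EF2 0 s u le_rfl hs0 hsu z₀ hz₀).symm
  have hwut : φ u t (w u) = w t := (hφ.EF2 0 u t le_rfl hu0 hut z₀ hz₀).symm
  have huT : u ∈ Icc 0 T := ⟨hu0, hut.trans htT⟩
  have hwu : InnerPart δ q (r u) (w u) := hwI u huT
  obtain ⟨F, hF⟩ := hφ.exists_isLogLift hr habc hs0 hsu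
  obtain ⟨G, hG⟩ := hφ.exists_isLogLift hr habc hu0 hut
  have hv : InnerPart δ' q' (r u) (φ s u z) :=
    himage (r s) (r u) (φ s u) F 1 (hr.mem_Ico s hs0).1 (hr.mem_Ico u hu0).1
      (hφ.mapsTo s u hs0 hsu) hF z (w s) (hzI s hSs) (hwI s ⟨hs0, hsu.trans huT.2⟩) (by rwa [hwsu])
  -- By EF2, `φ u t` sends `φ s u z` to `φ s t z` and `w u` to `w t`, so the displacement estimate
  -- compares exactly the increments of the two trajectories.
  have hmain := hC (r u) (r t) (φ u t) G (hr.mem_Ico t ht0).1 (hr.antitone hu0 hut)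
    (hr.mem_Ico u hu0).2 (hr.omega_antitone hu0 ht0 hut) (hφ.mapsTo u t hu0 hut) hG
    (φ s u z) (w u) hv (hwu.mono hδδ' hqq')
  rw [← hφ.EF2 s u t hs0 hsu hut z hsz, hwut] at hmain
  have hIcc : Icc u t ⊆ Icc S T := Icc_subset_Icc (hSs.trans hsu) htT
  have hint : ∀ {E : Type} [NormedAddCommGroup E] {g : ℝ → E},
      MemLp g d (volume.restrict (Icc S T)) →
      IntervalIntegrable (fun x => ‖g x‖) volume u t := by
    intro E _ g hg
    rw [intervalIntegrable_iff_integrableOn_Icc_of_le hut]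
    have : IntegrableOn (fun x => ‖g x‖) (Icc S T) := hg.norm.integrable hd
    exact this.mono_set hIcc
  have hiw := hint (htraj.deriv_memLp S T hST (hsubT S T hS))
  have hio := hint (hr.omega_ACd.deriv_memLp S T hST (hsubT S T hS))
  have h1 := (htraj.absolutelyContinuous u t hut (hsubT u t hu0)).norm_sub_le_integral hut hiw
  have h2 := (hr.omega_ACd.absolutelyContinuous u t hut (hsubT u t hu0)).abs_sub_le_integral hut
  have h3 := neg_le_abs (annulusOmega (r t) - annulusOmega (r u))
  rw [intervalIntegral.integral_const_mul, intervalIntegral.integral_add (hiw.const_mul 2) hio,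
    norm_sub_rev]
  refine hmain.trans (mul_le_mul_of_nonneg_left (add_le_add h1 ?_) hC0)
  linarith
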